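/- **Setting.** Let $\Theta\subset\mathbb R^d$ be open and let $\{P_\theta:\theta\in\Theta\}$ be a regular parametric model: the $P_\theta$ are probability measures dominated by a $\sigma$-finite measure $\mu$; with $s(\theta)=(dP_\theta/d\mu)^{1/2}$, the map $\theta\mapsto s(\theta)\in L_2(\mu)$ is Fréchet differentiable at every point of $\Theta$, with derivative $\dot s(\theta)$; $\theta\mapsto\dot s(\theta)$ is continuous into $L_2(\mu)$; and the information matrix $I(\theta)=4\int\dot s(\theta)\dot s(\theta)^T\,d\mu$ is nonsingular on $\Theta$. Let $\dot\ell(\theta)=2\dot s(\theta)/s(\theta)$ be the score (set to $0$ where $s(\theta)=0$). For $a\in L_2(P_\theta)$ let $\Pi(a,\theta)=\sum_j c_j(a,\theta)\dot\ell_j(\theta)$, where $c(a,\theta)$ minimizes $E_\theta\big(a-\sum_j c_j\dot\ell_j(\theta)\big)^2$ over $c\in\mathbb R^d$. Let $\theta_0\in\Theta$ be the true parameter, $P_0=P_{\theta_0}$, let $X_1,\dots,X_n$ be i.i.d. from $P_0$ with empirical measure $P_n$, and let $\hat\theta=\hat\theta_n(X_1,\dots,X_n)\in\Theta$ be measurable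 estimators. Let $h_\gamma(\cdot,\theta)$, $\gamma\in\Gamma$, $\theta\in\Theta$, be measurable real test functions. Write $$Z_n(\gamma,\theta)=n^{-1/2}\sum_{i=1}^n\big\{h_\gamma(X_i,\theta)-E_\theta h_\gamma(X_1,\theta)-\Pi(h_\gamma(\cdot,\theta),\theta)(X_i)\big\},\qquad \hat Z_n(\gamma)=\sqrt n\,(P_n-P_{\hat\theta})\,h_\gamma(\cdot,\hat\theta).$$ Weak convergence in $\ell^\infty$, tightness of sequences of processes, and $o_P$ are understood in the sense of Hoffmann-Jørgensen (outer expectations and outer probabilities). **Proposition 4.2.** Assume: * (R1) $\hat\theta$ is regular on $\Theta$: for every $\theta\in\Theta$ there is a probability law $L_\theta$ such that, for every sequence $(\theta_n)$ in $\Theta$ with $\sqrt n\,|\theta_n-\theta|$ bounded, the law of $\sqrt n(\hat\theta_n-\theta_n)$ under $P_{\theta_n}$ converges weakly to $L_\theta$. * (R2) $\Gamma$ is a compact subset of $[-\infty,\infty]^p$; the processes $(\gamma,\theta)\mapsto n^{1/2}(P_n-P_0)h_\gamma(\cdot,\theta)$ are asymptotically tight in $\ell^\infty(\Gamma\times\Theta)$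 under $P_0$; and $\sup_{x,\gamma,\theta}|h_\gamma(x,\theta)|<\infty$. * (R3) The map $\theta\mapsto h_\gamma(\cdot,\theta)$ is continuous on $\Theta$ in the norm $\|\omega\|^2=\sup_{\gamma}\int\omega^2(x,\gamma)\,dP_0(x)$ on functions of $(\gamma,x)$. * $\hat\theta$ is efficient at $\theta_0$: $\sqrt n(\hat\theta-\theta_0)=n^{-1/2}\sum_{i=1}^n I(\theta_0)^{-1}\dot\ell(X_i,\theta_0)+o_{P_0}(1)$. Then there is a tight mean-zero Gaussian process $Z(\cdot,\theta_0)$ in $\ell^\infty(\Gamma)$ with $$\operatorname{cov}\big(Z(\gamma_1,\theta_0),Z(\gamma_2,\theta_0)\big)=\operatorname{cov}_{\theta_0}(h_1,h_2)-\operatorname{cov}_{\theta_0}\big(\Pi(h_1,\theta_0),\Pi(h_2,\theta_0)\big),\qquad h_j=h_{\gamma_j}(\cdot,\theta_0),$$ such that, under $P_0$: 1. $Z_n(\cdot,\theta_0)\Rightarrow Z(\cdot,\theta_0)$ in $\ell^\infty(\Gamma)$; 2. $\sup_{\gamma\in\Gamma}|\hat Z_n(\gamma)-Z_n(\gamma,\theta_0)|=o_{P_0}(1)$;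 3. $\hat Z_n\Rightarrow Z(\cdot,\theta_0)$ in $\ell^\infty(\Gamma)$. -/

import Mathlib

open MeasureTheory ProbabilityTheory Filter Topology
open scoped ENNReal BoundedContinuousFunction

noncomputable section

namespace ScoreProcess

/-! ### Stochastic processes with bounded paths, in the sense of Hoffmann-Jørgensen -/

/-- `ℓ^∞(T)`: the bounded real functions on the set `T`, with the supremum norm. -/
abbrev LInf (T : Type*) : Type _ := lp (fun _ : T => ℝ) ∞

/-- `ℓ^∞(T)` carries the Borel σ-algebra of the supremum norm. -/
instance instMeasurableSpaceLInf (T : Type*) : MeasurableSpace (LInf T) := borel _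

instance instBorelSpaceLInf (T : Type*) : BorelSpace (LInf T) := ⟨rfl⟩

open Classical in
/-- A bounded function regarded as an element of `ℓ^∞(T)` (unbounded functions are sent to `0`;
wherever this is used, boundedness is asserted separately). -/
def toLInf {T : Type*} (w : T → ℝ) : LInf T :=
  if hw : Memℓp w ∞ then ⟨w, hw⟩ else 0

/-- Outer expectation `E^* g = inf {E U : U ≥ g, U measurable and integrable}`. -/
def outerExpectation {Ω : Type*} [MeasurableSpace Ω] (Q : Measure Ω) (g : Ω → ℝ) : ℝ :=
  sInf {r : ℝ | ∃ U : Ω → ℝ, Measurable U ∧ Integrable U Q ∧ (∀ ω, g ω ≤ U ω) ∧ r = ∫ ω, U ω ∂Q}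

/-- Weak convergence in `ℓ^∞(T)`, in the sense of Hoffmann-Jørgensen, of the (possibly
non-measurable) processes `W n`, defined on the probability spaces `(Ω n, Q n)`, to the Borel law
`ν`: the paths are bounded and `E^* f(W n) → ∫ f dν` for every bounded continuous `f`. -/
def ConvergesWeakly {T : Type*} {Ω : ℕ → Type*} [∀ n, MeasurableSpace (Ω n)]
    (Q : ∀ n, Measure (Ω n)) (W : ∀ n, Ω n → T → ℝ) (ν : Measure (LInf T)) : Prop :=
  (∀ n ω, Memℓp (W n ω) ∞) ∧
    ∀ f : LInf T →ᵇ ℝ,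
      Tendsto (fun n => outerExpectation (Q n) (fun ω => f (toLInf (W n ω)))) atTop
        (𝓝 (∫ z, f z ∂ν))

/-- Asymptotic tightness in `ℓ^∞(T)`: for every `ε > 0` there is a compact `K` such that, for every
`δ > 0`, the limsup of the outer probabilities that `W n` is not within `δ` of `K` is at most `ε`.
(A measure evaluated at an arbitrary set is the outer measure of the set.) -/
def AsymptoticallyTight {T : Type*} {Ω : ℕ → Type*} [∀ n, MeasurableSpace (Ω n)]
    (Q : ∀ n, Measure (Ω n)) (W : ∀ n, Ω n → T → ℝ) : Prop :=
  ∀ ε : ℝ, 0 < ε → ∃ K : Set (LInf T), IsCompact K ∧ ∀ δ : ℝ, 0 < δ →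
    limsup (fun n => Q n {ω | ¬ ∃ z ∈ K, ∀ t, |W n ω t - z t| < δ}) atTop ≤ ENNReal.ofReal ε

/-- `sup_t |W n t| = o_P(1)`, in outer probability. -/
def UniformlyNegligible {T : Type*} {Ω : ℕ → Type*} [∀ n, MeasurableSpace (Ω n)]
    (Q : ∀ n, Measure (Ω n)) (W : ∀ n, Ω n → T → ℝ) : Prop :=
  ∀ ε : ℝ, 0 < ε → Tendsto (fun n => Q n {ω | ∃ t, ε < |W n ω t|}) atTop (𝓝 0)

/-- `ν` is the law on `ℓ^∞(T)` of a tight mean-zero Gaussian process with covariance function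
`C`. -/
structure IsTightCenteredGaussian {T : Type*} (ν : Measure (LInf T)) (C : T → T → ℝ) : Prop where
  isProbabilityMeasure : IsProbabilityMeasure ν
  tight : IsTightMeasureSet {ν}
  gaussian : IsGaussianProcess (fun (t : T) (z : LInf T) => z t) ν
  mean : ∀ t, ∫ z, z t ∂ν = 0
  cov : ∀ t₁ t₂, cov[fun z : LInf T => z t₁, fun z : LInf T => z t₂; ν] = C t₁ t₂

/-! ### Regular parametric models -/

section Model

variable {𝓧 : Type*} [MeasurableSpace 𝓧] {d : ℕ} {Θ : Set (EuclideanSpace ℝ (Fin d))}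

/-- The law of an i.i.d. sample of size `n` from `P`. -/
def sampleLaw (P : Measure 𝓧) (n : ℕ) : Measure (Fin n → 𝓧) := Measure.pi fun _ => P

/-- The root density `s(θ) = (dP_θ/dμ)^{1/2}`. -/
def rootDensity (μ : Measure 𝓧) (P : Θ → Measure 𝓧) (θ : Θ) (x : 𝓧) : ℝ :=
  √((P θ).rnDeriv μ x).toReal

/-- The Fisher information matrix `I(θ) = 4 ∫ ṡ(θ) ṡ(θ)ᵀ dμ`. -/
def fisherInfo (μ : Measure 𝓧) (sdot : Θ → 𝓧 → EuclideanSpace ℝ (Fin d)) (θ : Θ) :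
    Matrix (Fin d) (Fin d) ℝ :=
  Matrix.of fun i j => 4 * ∫ x, sdot θ x i * sdot θ x j ∂μ

/-- `{P_θ : θ ∈ Θ}` is a regular parametric model: `Θ` is open, the `P_θ` are probability measures
dominated by the σ-finite measure `μ`, the map `θ ↦ s(θ)` into `L₂(μ)` is Fréchet differentiable at
every point of `Θ`, with derivative (a version of which is) `ṡ(θ)`, the information matrix is
nonsingular on `Θ`, and `θ ↦ ṡ(θ)` is continuous into `L₂(μ)`. -/
structure IsRegularParametric (μ : Measure 𝓧) (P : Θ → Measure 𝓧)
    (sdot : Θ → 𝓧 → EuclideanSpace ℝ (Fin d)) : Prop where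
  isOpen : IsOpen Θ
  sigmaFinite : SigmaFinite μ
  isProbabilityMeasure : ∀ θ, IsProbabilityMeasure (P θ)
  dominated : ∀ θ, P θ ≪ μ
  measurable_sdot : ∀ θ, Measurable (sdot θ)
  memLp_sdot : ∀ θ, MemLp (sdot θ) 2 μ
  differentiable : ∀ θ₀ : Θ,
    (fun θ : Θ => (eLpNorm (fun x => rootDensity μ P θ x - rootDensity μ P θ₀ x
        - inner ℝ (sdot θ₀ x) ((θ : EuclideanSpace ℝ (Fin d)) - θ₀)) 2 μ).toReal)
      =o[𝓝 θ₀] fun θ : Θ => ‖(θ : EuclideanSpace ℝ (Fin d)) - θ₀‖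
  nonsingular : ∀ θ, IsUnit (fisherInfo μ sdot θ).det
  continuous_sdot : ∀ θ₀ : Θ,
    Tendsto (fun θ : Θ => eLpNorm (fun x => sdot θ x - sdot θ₀ x) 2 μ) (𝓝 θ₀) (𝓝 0)

/-- The score `ℓ̇(θ) = 2 ṡ(θ) / s(θ)` (equal to `0` where `s(θ) = 0`), that is, the gradient in `θ`
of the log-likelihood. -/
def score (μ : Measure 𝓧) (P : Θ → Measure 𝓧) (sdot : Θ → 𝓧 → EuclideanSpace ℝ (Fin d))
    (θ : Θ) (x : 𝓧) : EuclideanSpace ℝ (Fin d) :=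
  (2 / rootDensity μ P θ x) • sdot θ x

/-- The efficient influence function `I(θ)⁻¹ ℓ̇(θ)`. -/
def efficientInfluence (μ : Measure 𝓧) (P : Θ → Measure 𝓧)
    (sdot : Θ → 𝓧 → EuclideanSpace ℝ (Fin d)) (θ : Θ) (x : 𝓧) : EuclideanSpace ℝ (Fin d) :=
  Matrix.toEuclideanLin (fisherInfo μ sdot θ)⁻¹ (score μ P sdot θ x)

/-- The estimator `θ̂` is regular at `θ₀`: whenever `√n (θ_n - θ₀)` is bounded, the law of
`√n (θ̂_n - θ_n)` under `P_{θ_n}` converges weakly to a probability law `L` that does not depend on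
the sequence `(θ_n)`. -/
def IsRegularEstimatorAt (P : Θ → Measure 𝓧) (est : ∀ n, (Fin n → 𝓧) → Θ) (θ₀ : Θ) : Prop :=
  ∃ L : Measure (EuclideanSpace ℝ (Fin d)), IsProbabilityMeasure L ∧
    ∀ θ : ℕ → Θ,
      (∃ B : ℝ, ∀ n : ℕ, √(n : ℝ) * ‖(θ n : EuclideanSpace ℝ (Fin d)) - θ₀‖ ≤ B) →
      ∀ f : EuclideanSpace ℝ (Fin d) →ᵇ ℝ,
        Tendsto (fun n : ℕ =>
            ∫ x, f (√(n : ℝ) • ((est n x : EuclideanSpace ℝ (Fin d)) - θ n))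
              ∂(sampleLaw (P (θ n)) n))
          atTop (𝓝 (∫ y, f y ∂L))

/-- The estimator `θ̂` is efficient at `θ₀`: it is asymptotically linear with the efficient
influence function, `√n (θ̂_n - θ₀) = n^{-1/2} ∑ I(θ₀)⁻¹ ℓ̇(X_i, θ₀) + o_P(1)` under `P_{θ₀}`. -/
def IsEfficientEstimatorAt (μ : Measure 𝓧) (P : Θ → Measure 𝓧)
    (sdot : Θ → 𝓧 → EuclideanSpace ℝ (Fin d)) (est : ∀ n, (Fin n → 𝓧) → Θ) (θ₀ : Θ) : Prop :=
  ∀ ε : ℝ, 0 < ε →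
    Tendsto (fun n : ℕ => sampleLaw (P θ₀) n
        {x | ε < ‖√(n : ℝ) • ((est n x : EuclideanSpace ℝ (Fin d)) - θ₀)
          - (√(n : ℝ))⁻¹ • ∑ i, efficientInfluence μ P sdot θ₀ (x i)‖})
      atTop (𝓝 0)

/-! ### Projection on the null tangent space and score processes -/

/-- `c` minimizes `E_θ (a(X₁) - ∑ⱼ cⱼ ℓ̇ⱼ(X₁, θ))²`. -/
def IsLeastSquares (μ : Measure 𝓧) (P : Θ → Measure 𝓧)
    (sdot : Θ → 𝓧 → EuclideanSpace ℝ (Fin d)) (a : 𝓧 → ℝ) (θ : Θ)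
    (c : EuclideanSpace ℝ (Fin d)) : Prop :=
  ∀ c' : EuclideanSpace ℝ (Fin d),
    ∫ x, (a x - inner ℝ c (score μ P sdot θ x)) ^ 2 ∂(P θ)
      ≤ ∫ x, (a x - inner ℝ c' (score μ P sdot θ x)) ^ 2 ∂(P θ)

/-- The coefficients `c(a, θ)` of the projection of `a ∈ L₂(P_θ)` on the tangent space
`span {ℓ̇₁(θ), …, ℓ̇_d(θ)}` (the minimizer exists and is unique when the information is
nonsingular). -/
def projCoeff (μ : Measure 𝓧) (P : Θ → Measure 𝓧) (sdot : Θ → 𝓧 → EuclideanSpace ℝ (Fin d))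
    (a : 𝓧 → ℝ) (θ : Θ) : EuclideanSpace ℝ (Fin d) :=
  Classical.epsilon (IsLeastSquares μ P sdot a θ)

/-- The projection `Π(a, θ) = ∑ⱼ cⱼ(a, θ) ℓ̇ⱼ(θ)`. -/
def tangentProj (μ : Measure 𝓧) (P : Θ → Measure 𝓧) (sdot : Θ → 𝓧 → EuclideanSpace ℝ (Fin d))
    (a : 𝓧 → ℝ) (θ : Θ) (x : 𝓧) : ℝ :=
  inner ℝ (projCoeff μ P sdot a θ) (score μ P sdot θ x)

variable {T : Type*}

/-- The empirical process `√n (P_n - P) h_t`, for a family of functions `h_t`. -/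
def empiricalProcess (P : Measure 𝓧) (h : T → 𝓧 → ℝ) (n : ℕ) (x : Fin n → 𝓧) (t : T) : ℝ :=
  √(n : ℝ) * ((n : ℝ)⁻¹ * ∑ i, h t (x i) - ∫ y, h t y ∂P)

/-- The score process
`Z_n(γ, θ) = n^{-1/2} ∑ᵢ {h_γ(Xᵢ, θ) - E_θ h_γ(X₁, θ) - Π(h_γ(·, θ), θ)(Xᵢ)}`. -/
def scoreProcess (μ : Measure 𝓧) (P : Θ → Measure 𝓧) (sdot : Θ → 𝓧 → EuclideanSpace ℝ (Fin d))
    (h : T → Θ → 𝓧 → ℝ) (θ : Θ) (n : ℕ) (x : Fin n → 𝓧) (γ : T) : ℝ :=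
  (√(n : ℝ))⁻¹ * ∑ i, (h γ θ (x i) - ∫ y, h γ θ y ∂(P θ) - tangentProj μ P sdot (h γ θ) θ (x i))

/-- The estimated score process `Ẑ_n(γ) = √n (P_n - P_θ̂) h_γ(·, θ̂)`. -/
def estimatedProcess (P : Θ → Measure 𝓧) (est : ∀ n, (Fin n → 𝓧) → Θ)
    (h : T → Θ → 𝓧 → ℝ) (n : ℕ) (x : Fin n → 𝓧) (γ : T) : ℝ :=
  empiricalProcess (P (est n x)) (fun γ => h γ (est n x)) n x γ

/-- The covariance function `cov_θ(h₁, h₂) - cov_θ(Π h₁, Π h₂)` of the limit process. -/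
def limitCov (μ : Measure 𝓧) (P : Θ → Measure 𝓧) (sdot : Θ → 𝓧 → EuclideanSpace ℝ (Fin d))
    (h : T → Θ → 𝓧 → ℝ) (θ : Θ) (γ₁ γ₂ : T) : ℝ :=
  cov[h γ₁ θ, h γ₂ θ; P θ]
    - cov[tangentProj μ P sdot (h γ₁ θ) θ, tangentProj μ P sdot (h γ₂ θ) θ; P θ]

end Model

end ScoreProcess

end

open ScoreProcess

/-! Write `G_n` for the empirical process under `P₀`, `b_γ = E₀[h_γ(·, θ₀) ℓ̇(θ₀)]`, `S_n` for the
normalized sum of the efficient influence function, and `Δ = θ̂ - θ₀`. The normal equations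
(`projCoeff_eq`) turn the projection term of the score process into `⟨b_γ, S_n⟩`, so that `Z_n(γ,
θ₀) = G_n h_γ(·, θ₀) - ⟨b_γ, S_n⟩` (`scoreProcess_eq`).

Tightness is used only through `FiniteOscillation`. The tight process `G_n` has this property, and
so does `⟨b_γ, S_n⟩`, because `γ ↦ b_γ` is bounded in a finite-dimensional space and `S_n` is
bounded in probability; hence `Z_n` has it too. Finite oscillation together with the multivariate
central limit theorem gives a weak limit (`FiniteOscillation.exists_weak_limit`,
`exists_gaussian_limit`). Its marginals come from an isonormal process on `L₂(P₀)`, so its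
covariance is the `L₂` inner product of the summands, computed from the orthogonality of the
projection.

For the estimated process, `Ẑ_n(γ) - Z_n(γ) = [G_n h_γ(·, θ̂) - G_n h_γ(·, θ₀)] - √n [P_θ̂ h_γ(·,
θ̂) - P₀ h_γ(·, θ̂) - ⟨Δ, b_γ⟩] - ⟨b_γ, √n Δ - S_n⟩`. The first bracket is small by equicontinuity
in the `L₂(P₀)` distance (`FiniteOscillation.equicontinuous`), the second by differentiability of
the root density (`eventually_abs_expansion_le`), and the last term by efficiency, all uniformly in
`γ`. A Slutsky argument then transfers the weak limit. -/

namespace ScoreProcess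

/-! ### Asymptotic equicontinuity over finite partitions -/

section Oscillation

variable {T : Type*} {Ω : ℕ → Type*} [∀ n, MeasurableSpace (Ω n)]

/-- For every `ε` there is a finite partition of the index set such that, with outer probability
eventually at least `1 - ε`, the paths oscillate by at most `ε` within each cell. -/
def FiniteOscillation (Q : ∀ n, Measure (Ω n)) (W : ∀ n, Ω n → T → ℝ) : Prop :=
  ∀ ε : ℝ, 0 < ε → ∃ (ι : Type) (_ : Finite ι) (c : T → ι), ∀ᶠ n in atTop,
    Q n {ω | ∃ s t, c s = c t ∧ ε < |W n ω s - W n ω t|} ≤ ENNReal.ofReal ε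

/-- A map with totally bounded range is, up to `ε`, constant on the cells of a finite partition. -/
lemma exists_finite_partition_dist_lt {E : Type*} [PseudoMetricSpace E] (φ : T → E)
    (hφ : TotallyBounded (Set.range φ)) {ε : ℝ} (hε : 0 < ε) :
    ∃ (ι : Type) (_ : Finite ι) (c : T → ι), ∀ s t, c s = c t → dist (φ s) (φ t) < ε := by
  obtain ⟨F, -, hF, hcov⟩ := Metric.finite_approx_of_totallyBounded hφ (ε / 2) (half_pos hε)
  have hex : ∀ t, ∃ y : F, dist (φ t) y < ε / 2 := fun t => by
    obtain ⟨y, hy, hd⟩ := Set.mem_iUnion₂.1 (hcov ⟨t, rfl⟩)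
    exact ⟨⟨y, hy⟩, hd⟩
  choose c hc using hex
  have := hF.to_subtype
  obtain ⟨m, ⟨e⟩⟩ := Finite.exists_equiv_fin F
  refine ⟨Fin m, inferInstance, fun t => e (c t), fun s t hst => ?_⟩
  have h1 := hc s
  have h2 := hc t
  rw [e.injective hst] at h1
  calc dist (φ s) (φ t) ≤ dist (φ s) (c t) + dist (φ t) (c t) := dist_triangle_right _ _ _
    _ < ε := by linarith

lemma abs_apply_sub_le_dist (z z' : LInf T) (t : T) : |z t - z' t| ≤ dist z z' := by
  rw [dist_eq_norm]
  exact lp.norm_apply_le_norm ENNReal.top_ne_zero (z - z') t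

variable {Q : ∀ n, Measure (Ω n)} {W W' : ∀ n, Ω n → T → ℝ}

/-- A compact set of paths has a finite net, and indices at which all net elements nearly agree form
finitely many cells. A path close to the compact set is close to a net element, so it too is nearly
constant on each cell. -/
lemma AsymptoticallyTight.finiteOscillation (h : AsymptoticallyTight Q W) :
    FiniteOscillation Q W := by
  intro ε hε
  -- Asking for `ε / 2` makes the limsup strictly less than `ε`, which yields an eventual bound by
  -- `ε`.
  obtain ⟨K, hK, hlim⟩ := h (ε / 2) (half_pos hε)
  obtain ⟨F, -, hF, hcov⟩ :=
    Metric.finite_approx_of_totallyBounded hK.totallyBounded (ε / 8) (by positivity)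
  have := hF.fintype
  let φ : T → (F → ℝ) := fun t z => z.1 t
  have hφ : TotallyBounded (Set.range φ) := by
    refine TotallyBounded.subset subset_closure
      (Bornology.IsBounded.isCompact_closure ?_).totallyBounded
    refine isBounded_iff_forall_norm_le.2 ⟨∑ z : F, ‖z.1‖, ?_⟩
    rintro _ ⟨t, rfl⟩
    refine (pi_norm_le_iff_of_nonneg (by positivity)).2 fun z => ?_
    exact (lp.norm_apply_le_norm ENNReal.top_ne_zero z.1 t).trans
      (Finset.single_le_sum (f := fun z : F => ‖z.1‖) (fun _ _ => norm_nonneg _)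
        (Finset.mem_univ z))
  obtain ⟨ι, hι, c, hc⟩ := exists_finite_partition_dist_lt φ hφ (ε := ε / 8) (by positivity)
  refine ⟨ι, hι, c, ?_⟩
  have hlt : limsup (fun n => Q n {ω | ¬ ∃ z ∈ K, ∀ t, |W n ω t - z t| < ε / 8}) atTop
      < ENNReal.ofReal ε :=
    (hlim _ (by positivity)).trans_lt ((ENNReal.ofReal_lt_ofReal_iff hε).2 (by linarith))
  filter_upwards [eventually_lt_of_limsup_lt hlt] with n hn
  refine (measure_mono ?_).trans hn.le
  rintro ω ⟨s, t, hst, hlt⟩ ⟨z, hz, hzW⟩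
  obtain ⟨y, hy, hd⟩ := Set.mem_iUnion₂.1 (hcov hz)
  have h1 := hzW s
  have h2 := hzW t
  have h3 := (abs_apply_sub_le_dist z y s).trans_lt hd
  -- Five errors of `ε / 8`: from `W` to `z` and from `z` to `y` at both indices, and from `y s` to
  -- `y t`.
  have h4 := (abs_apply_sub_le_dist z y t).trans_lt hd
  have h5 : |y s - y t| < ε / 8 :=
    (dist_le_pi_dist (φ s) (φ t) ⟨y, hy⟩).trans_lt (hc s t hst)
  rw [abs_lt] at *
  rcases lt_abs.1 hlt with h | h <;> linarith

lemma FiniteOscillation.comp {S : Type*} (h : FiniteOscillation Q W) (j : S → T) :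
    FiniteOscillation Q (fun n ω s => W n ω (j s)) := by
  intro ε hε
  obtain ⟨ι, hι, c, hc⟩ := h ε hε
  refine ⟨ι, hι, c ∘ j, hc.mono fun n hn => (measure_mono ?_).trans hn⟩
  rintro ω ⟨s, t, hst, hlt⟩
  exact ⟨j s, j t, hst, hlt⟩

lemma FiniteOscillation.sub (h : FiniteOscillation Q W) (h' : FiniteOscillation Q W') :
    FiniteOscillation Q (fun n ω t => W n ω t - W' n ω t) := by
  intro ε hε
  obtain ⟨ι, hι, c, hc⟩ := h (ε / 2) (half_pos hε)
  obtain ⟨ι', hι', c', hc'⟩ := h' (ε / 2) (half_pos hε)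
  refine ⟨ι × ι', inferInstance, fun t => (c t, c' t), ?_⟩
  filter_upwards [hc, hc'] with n hn hn'
  calc _ ≤ Q n ({ω | ∃ s t, c s = c t ∧ ε / 2 < |W n ω s - W n ω t|} ∪
        {ω | ∃ s t, c' s = c' t ∧ ε / 2 < |W' n ω s - W' n ω t|}) := by
        refine measure_mono ?_
        rintro ω ⟨s, t, hst, hlt⟩
        rw [Prod.mk.injEq] at hst
        by_contra hcon
        simp only [Set.mem_union, Set.mem_ofPred_eq, not_or, not_exists, not_and, not_lt] at hcon
        have h1 := abs_le.1 (hcon.1 s t hst.1)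
        have h2 := abs_le.1 (hcon.2 s t hst.2)
        rcases lt_abs.1 hlt with h | h <;> linarith [h1.1, h1.2, h2.1, h2.2]
    _ ≤ _ := measure_union_le _ _
    _ ≤ ENNReal.ofReal (ε / 2) + ENNReal.ofReal (ε / 2) := add_le_add hn hn'
    _ = ENNReal.ofReal ε := by
        rw [← ENNReal.ofReal_add (by positivity) (by positivity), add_halves]

/-- The random vectors `S n` are bounded in outer probability. -/
def BoundedInProbability {E : Type*} [NormedAddCommGroup E] (Q : ∀ n, Measure (Ω n))
    (S : ∀ n, Ω n → E) : Prop :=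
  ∀ ε : ℝ, 0 < ε → ∃ R : ℝ, 0 < R ∧ ∀ᶠ n in atTop, Q n {ω | R < ‖S n ω‖} ≤ ENNReal.ofReal ε

/-- The coefficients `b t` lie in a bounded, hence totally bounded, subset of a finite-dimensional
space; cells of diameter below `ε / R` suffice on the event `‖S n‖ ≤ R`. -/
lemma FiniteOscillation.inner {d : ℕ} {S : ∀ n, Ω n → EuclideanSpace ℝ (Fin d)}
    (hS : BoundedInProbability Q S) {b : T → EuclideanSpace ℝ (Fin d)} {B : ℝ}
    (hb : ∀ t, ‖b t‖ ≤ B) : FiniteOscillation Q (fun n ω t => inner ℝ (b t) (S n ω)) := by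
  intro ε hε
  obtain ⟨R, hR, hSR⟩ := hS ε hε
  have htb : TotallyBounded (Set.range b) := by
    refine TotallyBounded.subset subset_closure
      (Bornology.IsBounded.isCompact_closure ?_).totallyBounded
    exact isBounded_iff_forall_norm_le.2 ⟨B, by rintro _ ⟨t, rfl⟩; exact hb t⟩
  obtain ⟨ι, hι, c, hc⟩ := exists_finite_partition_dist_lt b htb (ε := ε / R) (by positivity)
  refine ⟨ι, hι, c, hSR.mono fun n hn => (measure_mono ?_).trans hn⟩
  rintro ω ⟨s, t, hst, hlt⟩
  by_contra hcon
  have hcon : ‖S n ω‖ ≤ R := not_lt.1 hcon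
  rw [← inner_sub_left] at hlt
  have h1 := (abs_real_inner_le_norm (b s - b t) (S n ω))
  have h2 := hc s t hst
  rw [dist_eq_norm] at h2
  have h3 : ‖b s - b t‖ * ‖S n ω‖ ≤ ε / R * R := by gcongr
  rw [div_mul_cancel₀ _ hR.ne'] at h3
  linarith

/-- A process with finite oscillation whose increments are small in probability for `ρ`-close
indices is asymptotically uniformly `ρ`-equicontinuous in outer probability. -/
lemma FiniteOscillation.equicontinuous (h : FiniteOscillation Q W) {ρ : T → T → ℝ}
    (hρ : ∀ ε η : ℝ, 0 < ε → 0 < η → ∃ δ : ℝ, 0 < δ ∧ ∀ s t, ρ s t < δ → ∀ n,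
      Q n {ω | ε < |W n ω s - W n ω t|} ≤ ENNReal.ofReal η) {ε : ℝ} (hε : 0 < ε) :
    ∃ δ : ℝ, 0 < δ ∧ ∀ᶠ n in atTop,
      Q n {ω | ∃ s t, ρ s t < δ ∧ ε < |W n ω s - W n ω t|} ≤ ENNReal.ofReal ε := by
  obtain ⟨ι, hι, c, hc⟩ := h (ε / 3) (by positivity)
  have := Fintype.ofFinite ι
  have hη : 0 < ε / 3 / (Fintype.card (ι × ι) + 1) := by positivity
  obtain ⟨δ₀, hδ₀, hδ⟩ := hρ (ε / 3) _ (by positivity) hη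
  refine ⟨δ₀, hδ₀, ?_⟩
  -- For each pair of cells containing a `ρ`-close pair of indices, one such pair is fixed;
  -- otherwise the event is empty. Every other `ρ`-close pair in these cells is compared with it at
  -- the cost of two oscillations within cells, so a supremum over all close pairs reduces to
  -- finitely many increments.
  let B : ∀ n, ι × ι → Set (Ω n) := fun n p =>
    {ω | ∃ hp : ∃ st : T × T, c st.1 = p.1 ∧ c st.2 = p.2 ∧ ρ st.1 st.2 < δ₀,
      ε / 3 < |W n ω hp.choose.1 - W n ω hp.choose.2|}
  have hB : ∀ n p, Q n (B n p) ≤ ENNReal.ofReal (ε / 3 / (Fintype.card (ι × ι) + 1)) := by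
    intro n p
    by_cases hp : ∃ st : T × T, c st.1 = p.1 ∧ c st.2 = p.2 ∧ ρ st.1 st.2 < δ₀
    · refine (measure_mono ?_).trans (hδ _ _ hp.choose_spec.2.2 n)
      rintro ω ⟨_, hω⟩
      exact hω
    · have : B n p = ∅ := by
        ext ω
        simp only [Set.mem_empty_iff_false, iff_false]
        rintro ⟨hp', -⟩
        exact hp hp'
      simp [this]
  filter_upwards [hc] with n hn
  calc _ ≤ Q n ({ω | ∃ s t, c s = c t ∧ ε / 3 < |W n ω s - W n ω t|} ∪ ⋃ p, B n p) := by
        refine measure_mono ?_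
        rintro ω ⟨s, t, hst, hlt⟩
        by_contra hcon
        simp only [Set.mem_union, Set.mem_ofPred_eq, not_or, not_exists, not_and, not_lt,
          Set.mem_iUnion] at hcon
        have hp : ∃ st : T × T, c st.1 = c s ∧ c st.2 = c t ∧ ρ st.1 st.2 < δ₀ :=
          ⟨(s, t), rfl, rfl, hst⟩
        have h0 := hp.choose_spec
        have h1 := abs_le.1 (hcon.1 hp.choose.1 s h0.1)
        have h2 := abs_le.1 (hcon.1 hp.choose.2 t h0.2.1)
        have h3 : |W n ω hp.choose.1 - W n ω hp.choose.2| ≤ ε / 3 :=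
          not_lt.1 fun hlt => hcon.2 (c s, c t) ⟨hp, hlt⟩
        have h3 := abs_le.1 h3
        rcases lt_abs.1 hlt with h | h <;> linarith [h1.1, h1.2, h2.1, h2.2, h3.1, h3.2]
    _ ≤ _ := measure_union_le _ _
    _ ≤ ENNReal.ofReal (ε / 3) +
        ∑ _p : ι × ι, ENNReal.ofReal (ε / 3 / (Fintype.card (ι × ι) + 1)) :=
        add_le_add hn ((measure_iUnion_fintype_le _ _).trans
          (Finset.sum_le_sum fun p _ => hB n p))
    _ ≤ ENNReal.ofReal ε := by
        rw [← ENNReal.ofReal_sum_of_nonneg fun _ _ => hη.le,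
          ← ENNReal.ofReal_add (by positivity) (by positivity)]
        refine ENNReal.ofReal_le_ofReal ?_
        rw [Finset.sum_const, Finset.card_univ, nsmul_eq_mul]
        have : (Fintype.card (ι × ι) : ℝ) * (ε / 3 / (Fintype.card (ι × ι) + 1)) ≤ ε / 3 := by
          rw [mul_div_assoc', div_le_iff₀ (by positivity)]
          nlinarith
        linarith

end Oscillation


/-! ### Outer expectations -/

section OuterExpectation

variable {Ω : Type*} [MeasurableSpace Ω] {Q : Measure Ω}

lemma outerExpectation_set_nonempty [IsFiniteMeasure Q] {g : Ω → ℝ} {M : ℝ} (hg : ∀ ω, g ω ≤ M) :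
    {r : ℝ | ∃ U : Ω → ℝ, Measurable U ∧ Integrable U Q ∧ (∀ ω, g ω ≤ U ω) ∧
      r = ∫ ω, U ω ∂Q}.Nonempty :=
  ⟨_, fun _ => M, measurable_const, integrable_const M, hg, rfl⟩

lemma outerExpectation_set_bddBelow [IsProbabilityMeasure Q] {g : Ω → ℝ} {M : ℝ}
    (hg : ∀ ω, M ≤ g ω) :
    BddBelow {r : ℝ | ∃ U : Ω → ℝ, Measurable U ∧ Integrable U Q ∧ (∀ ω, g ω ≤ U ω) ∧
      r = ∫ ω, U ω ∂Q} := by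
  refine ⟨M, ?_⟩
  rintro r ⟨U, -, hU, hgU, rfl⟩
  have := integral_mono (integrable_const M) hU fun ω => (hg ω).trans (hgU ω)
  simpa using this

/-- If `g' ≤ g + η` off a set `A`, and both functions are bounded by `M`, then
`E^* g' ≤ E^* g + η + 2 M Q(A)`. -/
lemma outerExpectation_le_add [IsProbabilityMeasure Q] {g g' : Ω → ℝ} {M η a : ℝ} {A : Set Ω}
    (hg : ∀ ω, |g ω| ≤ M) (hg' : ∀ ω, |g' ω| ≤ M) (hη : 0 ≤ η) (ha : 0 ≤ a)
    (hA : Q A ≤ ENNReal.ofReal a) (h : ∀ ω, ω ∉ A → g' ω ≤ g ω + η) :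
    outerExpectation Q g' ≤ outerExpectation Q g + η + 2 * M * a := by
  have hM : 0 ≤ M := by
    obtain ⟨ω⟩ := nonempty_of_isProbabilityMeasure Q
    exact (abs_nonneg _).trans (hg ω)
  rw [← sub_le_iff_le_add, ← sub_le_iff_le_add]
  refine le_csInf (outerExpectation_set_nonempty fun ω => (abs_le.1 (hg ω)).2) ?_
  rintro r ⟨U, hUm, hU, hgU, rfl⟩
  rw [sub_le_iff_le_add, sub_le_iff_le_add]
  -- A measurable majorant of `g'`: `A` need not be measurable, so the correction `2 * M` is placed
  -- on its measurable hull, which has the same measure.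
  let V : Ω → ℝ := fun ω => U ω + η + (toMeasurable Q A).indicator (fun _ => 2 * M) ω
  have hind : Integrable ((toMeasurable Q A).indicator fun _ => 2 * M) Q :=
    (integrable_const _).indicator (measurableSet_toMeasurable _ _)
  have hVi : Integrable V Q := (hU.add (integrable_const η)).add hind
  have hle : outerExpectation Q g' ≤ ∫ ω, V ω ∂Q := by
    refine csInf_le (outerExpectation_set_bddBelow fun ω => (abs_le.1 (hg' ω)).1)
      ⟨V, ?_, hVi, fun ω => ?_, rfl⟩
    · exact (hUm.add_const η).add (measurable_const.indicator (measurableSet_toMeasurable _ _))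
    · have h1 := hgU ω
      by_cases hω : ω ∈ toMeasurable Q A
      · simp only [V, Set.indicator_of_mem hω]
        linarith [(abs_le.1 (hg ω)).1, (abs_le.1 (hg' ω)).2]
      · simp only [V, Set.indicator_of_notMem hω]
        linarith [h ω fun hA => hω (subset_toMeasurable Q A hA)]
  refine hle.trans ?_
  have hUη : Integrable (fun ω => U ω + η) Q := hU.add (integrable_const η)
  rw [integral_add hUη hind, integral_add hU (integrable_const η),
    integral_indicator_const _ (measurableSet_toMeasurable _ _)]
  have : Q.real (toMeasurable Q A) ≤ a := by
    rw [Measure.real, measure_toMeasurable]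
    exact ENNReal.toReal_le_of_le_ofReal ha hA
  simp only [integral_const, smul_eq_mul, probReal_univ, one_mul]
  nlinarith

lemma outerExpectation_mono [IsProbabilityMeasure Q] {g g' : Ω → ℝ} {M M' : ℝ}
    (hg : ∀ ω, |g ω| ≤ M) (hg' : ∀ ω, |g' ω| ≤ M') (h : ∀ ω, g ω ≤ g' ω) :
    outerExpectation Q g ≤ outerExpectation Q g' := by
  have := outerExpectation_le_add (Q := Q) (g := g') (g' := g) (M := max M M') (η := 0) (a := 0)
    (A := ∅) (fun ω => (hg' ω).trans (le_max_right _ _)) (fun ω => (hg ω).trans (le_max_left _ _))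
    le_rfl le_rfl (by simp) (fun ω _ => by simpa using h ω)
  simpa using this

lemma outerExpectation_eq_integral [IsProbabilityMeasure Q] {g : Ω → ℝ} (hg : Measurable g)
    {M : ℝ} (hM : ∀ ω, |g ω| ≤ M) : outerExpectation Q g = ∫ ω, g ω ∂Q := by
  have hgi : Integrable g Q :=
    Integrable.of_bound hg.aestronglyMeasurable M (Eventually.of_forall hM)
  refine le_antisymm (csInf_le (outerExpectation_set_bddBelow fun ω => (abs_le.1 (hM ω)).1)
    ⟨g, hg, hgi, fun _ => le_rfl, rfl⟩) ?_
  refine le_csInf (outerExpectation_set_nonempty fun ω => (abs_le.1 (hM ω)).2) ?_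
  rintro r ⟨U, -, hU, hgU, rfl⟩
  exact integral_mono hgi hU hgU

end OuterExpectation

/-! ### Lipschitz approximation of bounded continuous functions -/

section InfConvolution

variable {E : Type*} [PseudoMetricSpace E]

/-- The Lipschitz regularization `x ↦ inf_y (f y + m d(x, y))`. -/
noncomputable def lipschitzReg (f : E →ᵇ ℝ) (m : ℕ) (x : E) : ℝ := ⨅ y, (f y + m * dist x y)

variable (f : E →ᵇ ℝ) (m : ℕ)

lemma lipschitzReg_bddBelow (x : E) : BddBelow (Set.range fun y => f y + m * dist x y) := by
  refine ⟨-‖f‖, ?_⟩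
  rintro _ ⟨y, rfl⟩
  have := (abs_le.1 (f.norm_coe_le_norm y)).1
  have : (0 : ℝ) ≤ m * dist x y := by positivity
  linarith

lemma lipschitzReg_le (x : E) : lipschitzReg f m x ≤ f x :=
  (ciInf_le (lipschitzReg_bddBelow f m x) x).trans (by simp)

lemma abs_lipschitzReg_le (x : E) : |lipschitzReg f m x| ≤ ‖f‖ := by
  have : Nonempty E := ⟨x⟩
  refine abs_le.2 ⟨le_ciInf fun y => ?_,
    (lipschitzReg_le f m x).trans (abs_le.1 (f.norm_coe_le_norm x)).2⟩
  have := (abs_le.1 (f.norm_coe_le_norm y)).1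
  have : (0 : ℝ) ≤ m * dist x y := by positivity
  linarith

lemma lipschitzWith_lipschitzReg : LipschitzWith m (lipschitzReg f m) := by
  refine LipschitzWith.of_le_add_mul _ fun x x' => ?_
  have : Nonempty E := ⟨x⟩
  rw [← sub_le_iff_le_add]
  refine le_ciInf fun y => ?_
  rw [sub_le_iff_le_add]
  refine (ciInf_le (lipschitzReg_bddBelow f m x) y).trans ?_
  have := dist_triangle x x' y
  have hm : (0 : ℝ) ≤ m := Nat.cast_nonneg m
  push_cast
  nlinarith

/-- Once `m * δ ≥ 2 * ‖f‖`, the penalty excludes every `y` at distance at least `δ` from `x`, and at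
closer points `f y` is near `f x` by continuity. -/
lemma tendsto_lipschitzReg (x : E) :
    Tendsto (fun m => lipschitzReg f m x) atTop (𝓝 (f x)) := by
  have : Nonempty E := ⟨x⟩
  refine Metric.tendsto_atTop.2 fun ε hε => ?_
  obtain ⟨δ, hδ, hfδ⟩ := Metric.continuous_iff.1 f.continuous x (ε / 2) (half_pos hε)
  obtain ⟨N, hN⟩ := exists_nat_gt (2 * ‖f‖ / δ)
  refine ⟨N, fun m hm => ?_⟩
  have hlow : f x - ε / 2 ≤ lipschitzReg f m x := by
    refine le_ciInf fun y => ?_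
    rcases lt_or_ge (dist y x) δ with h | h
    · have h1 := abs_lt.1 (hfδ y h)
      have : (0 : ℝ) ≤ m * dist x y := by positivity
      linarith [h1.1]
    · have h1 : 2 * ‖f‖ ≤ m * dist x y := by
        rw [dist_comm] at h
        rw [div_lt_iff₀ hδ] at hN
        have : (N : ℝ) ≤ m := by exact_mod_cast hm
        nlinarith
      linarith [(abs_le.1 (f.norm_coe_le_norm y)).1, (abs_le.1 (f.norm_coe_le_norm x)).2]
  rw [Real.dist_eq, abs_lt]
  constructor <;> linarith [lipschitzReg_le f m x]

end InfConvolution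

/-! ### Lipschitz test functions and Slutsky's lemma -/

section WeakConvergence

variable {T : Type*} {Ω : ℕ → Type*} [∀ n, MeasurableSpace (Ω n)]
  {Q : ∀ n, Measure (Ω n)} [∀ n, IsProbabilityMeasure (Q n)]
  {W W' : ∀ n, Ω n → T → ℝ} {ν : Measure (LInf T)}

/-- It is enough to test weak convergence on bounded Lipschitz functions. -/
lemma convergesWeakly_of_lipschitz [IsProbabilityMeasure ν] (hW : ∀ n ω, Memℓp (W n ω) ∞)
    (h : ∀ (f : LInf T →ᵇ ℝ) (K : ℕ), LipschitzWith K f →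
      Tendsto (fun n => outerExpectation (Q n) fun ω => f (toLInf (W n ω))) atTop
        (𝓝 (∫ z, f z ∂ν))) :
    ConvergesWeakly Q W ν := by
  refine ⟨hW, fun f => ?_⟩
  have hb : ∀ (g : LInf T →ᵇ ℝ) z, |g z| ≤ ‖g‖ := fun g z => g.norm_coe_le_norm z
  let low : (LInf T →ᵇ ℝ) → ℕ → (LInf T →ᵇ ℝ) := fun g m =>
    BoundedContinuousFunction.ofNormedAddCommGroup (lipschitzReg g m)
      (lipschitzWith_lipschitzReg g m).continuous ‖g‖ (abs_lipschitzReg_le g m)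
  have hlow : ∀ g, Tendsto (fun m => ∫ z, low g m z ∂ν) atTop (𝓝 (∫ z, g z ∂ν)) := by
    intro g
    refine tendsto_integral_of_dominated_convergence (fun _ => ‖g‖)
      (fun m => (low g m).continuous.measurable.aestronglyMeasurable)
      (integrable_const _) (fun m => Eventually.of_forall (abs_lipschitzReg_le g m))
      (Eventually.of_forall (tendsto_lipschitzReg g))
  have key : ∀ (g : LInf T →ᵇ ℝ) (ε : ℝ), 0 < ε → ∀ᶠ n in atTop,
      ∫ z, g z ∂ν - ε < outerExpectation (Q n) fun ω => g (toLInf (W n ω)) := by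
    intro g ε hε
    obtain ⟨m, hm⟩ := ((hlow g).eventually (lt_mem_nhds (sub_lt_self _ hε))).exists
    filter_upwards [(h (low g m) m (lipschitzWith_lipschitzReg g m)).eventually (lt_mem_nhds hm)]
      with n hn
    exact hn.trans_le (outerExpectation_mono (fun ω => hb _ _) (fun ω => hb _ _)
      fun ω => lipschitzReg_le g m _)
  refine tendsto_order.2 ⟨fun a ha => ?_, fun a ha => ?_⟩
  · simpa using key f _ (sub_pos.2 ha)
  -- Outer expectation does not commute with negation, so `key` cannot be applied to `-f`. Instead
  -- the negative of the regularization of `-f` serves as a Lipschitz majorant of `f`.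
  · obtain ⟨m, hm⟩ := ((hlow (-f)).eventually
      (lt_mem_nhds (show -a < ∫ z, (-f) z ∂ν by simpa [integral_neg] using ha))).exists
    have hL : LipschitzWith m (-(low (-f) m)) := (lipschitzWith_lipschitzReg (-f) m).neg
    have hm' : ∫ z, (-(low (-f) m)) z ∂ν < a := by
      simp only [BoundedContinuousFunction.coe_neg, Pi.neg_apply, integral_neg]
      linarith
    filter_upwards [(h _ m hL).eventually (gt_mem_nhds hm')] with n hn
    refine (outerExpectation_mono (fun ω => hb _ _) (fun ω => hb _ _) fun ω => ?_).trans_lt hn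
    have : lipschitzReg (-f) m (toLInf (W n ω)) ≤ _ := lipschitzReg_le (-f) m _
    exact le_neg.2 this

lemma toLInf_apply {w : T → ℝ} (hw : Memℓp w ∞) (t : T) : toLInf w t = w t := by
  simp [toLInf, hw]

lemma dist_toLInf_le {w w' : T → ℝ} (hw : Memℓp w ∞) (hw' : Memℓp w' ∞) {c : ℝ} (hc : 0 ≤ c)
    (h : ∀ t, |w t - w' t| ≤ c) : dist (toLInf w) (toLInf w') ≤ c := by
  rw [dist_eq_norm]
  refine lp.norm_le_of_forall_le hc fun t => ?_
  rw [lp.coeFn_sub, Pi.sub_apply, toLInf_apply hw, toLInf_apply hw']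
  exact h t

/-- For a Lipschitz `f`, the outer expectations of `f(W)` and `f(W')` are close when `W` and `W'`
are uniformly close with large outer probability. -/
lemma abs_outerExpectation_sub_le {Ω : Type*} [MeasurableSpace Ω] {Q : Measure Ω}
    [IsProbabilityMeasure Q] {W W' : Ω → T → ℝ} (hW : ∀ ω, Memℓp (W ω) ∞)
    (hW' : ∀ ω, Memℓp (W' ω) ∞) (f : LInf T →ᵇ ℝ) {K : ℕ} (hf : LipschitzWith K f) {η : ℝ}
    (hη : 0 ≤ η) (hA : Q {ω | ∃ t, η < |W ω t - W' ω t|} ≤ ENNReal.ofReal η) :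
    |outerExpectation Q (fun ω => f (toLInf (W ω))) -
      outerExpectation Q (fun ω => f (toLInf (W' ω)))| ≤ (K + 2 * ‖f‖) * η := by
  have hb : ∀ z, |f z| ≤ ‖f‖ := fun z => f.norm_coe_le_norm z
  have hd : ∀ ω, ω ∉ {ω | ∃ t, η < |W ω t - W' ω t|} →
      |f (toLInf (W ω)) - f (toLInf (W' ω))| ≤ K * η := by
    intro ω hω
    have hω : ∀ t, |W ω t - W' ω t| ≤ η := fun t => not_lt.1 fun hlt => hω ⟨t, hlt⟩
    refine (hf.dist_le_mul _ _).trans ?_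
    push_cast
    exact mul_le_mul_of_nonneg_left (dist_toLInf_le (hW ω) (hW' ω) hη hω) (Nat.cast_nonneg K)
  have h1 := outerExpectation_le_add (Q := Q) (g := fun ω => f (toLInf (W ω)))
    (g' := fun ω => f (toLInf (W' ω))) (fun ω => hb _) (fun ω => hb _) (η := K * η) (by positivity)
    hη hA (fun ω hω => by linarith [(abs_le.1 (hd ω hω)).1])
  have h2 := outerExpectation_le_add (Q := Q) (g := fun ω => f (toLInf (W' ω)))
    (g' := fun ω => f (toLInf (W ω))) (fun ω => hb _) (fun ω => hb _) (η := K * η) (by positivity)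
    hη hA (fun ω hω => by linarith [(abs_le.1 (hd ω hω)).2])
  rw [abs_le]
  constructor <;> linarith

/-- Slutsky's lemma: for a Lipschitz test function, uniform closeness off a set of small outer
probability controls the difference of outer expectations, with no measurability of either process.
-/
lemma ConvergesWeakly.of_uniformlyNegligible [IsProbabilityMeasure ν]
    (h : ConvergesWeakly Q W ν) (hW' : ∀ n ω, Memℓp (W' n ω) ∞)
    (hn : UniformlyNegligible Q fun n ω t => W' n ω t - W n ω t) : ConvergesWeakly Q W' ν := by
  refine convergesWeakly_of_lipschitz hW' fun f K hf => ?_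
  refine Metric.tendsto_atTop'.2 fun ε hε => ?_
  have hpos : 0 < K + 2 * ‖f‖ + 1 := by positivity
  have hη : 0 < ε / 2 / (K + 2 * ‖f‖ + 1) := by positivity
  obtain ⟨N, hN⟩ := eventually_atTop.1 (((hn _ hη).eventually
    (ge_mem_nhds (ENNReal.ofReal_pos.2 hη))).and (Metric.tendsto_nhds.1 (h.2 f) (ε / 2)
      (half_pos hε)))
  refine ⟨N, fun n hnN => ?_⟩
  obtain ⟨h1, h2⟩ := hN n hnN.le
  have h3 := abs_outerExpectation_sub_le (hW' n) (h.1 n) f hf hη.le h1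
  have h4 : (K + 2 * ‖f‖) * (ε / 2 / (K + 2 * ‖f‖ + 1)) ≤ ε / 2 := by
    rw [mul_div_assoc', div_le_iff₀ hpos]
    nlinarith
  rw [Real.dist_eq] at h2 ⊢
  have := abs_sub_le (outerExpectation (Q n) fun ω => f (toLInf (W' n ω)))
    (outerExpectation (Q n) fun ω => f (toLInf (W n ω))) (∫ z, f z ∂ν)
  linarith

end WeakConvergence


/-! ### Weak limits from finite oscillation and finite-dimensional convergence -/

section WeakLimit

variable {T : Type*} {Ω : ℕ → Type*} [∀ n, MeasurableSpace (Ω n)]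
  {Q : ∀ n, Measure (Ω n)} {W : ∀ n, Ω n → T → ℝ}

/-- Replacing each path by its values at one representative per cell leaves a process governed by a
vector in `Fin m → ℝ`, to which finite-dimensional convergence applies. -/
lemma FiniteOscillation.exists_approx (h : FiniteOscillation Q W) {ε : ℝ} (hε : 0 < ε) :
    ∃ (m : ℕ) (c : T → Fin m) (r : Fin m → T), ∀ᶠ n in atTop,
      Q n {ω | ∃ t, ε < |W n ω t - W n ω (r (c t))|} ≤ ENNReal.ofReal ε := by
  obtain ⟨ι, hι, c, hc⟩ := h ε hε
  -- Labels that are not attained are discarded, so that every remaining cell has a representative.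
  obtain ⟨m, ⟨e⟩⟩ := Finite.exists_equiv_fin (Set.range c)
  refine ⟨m, fun t => e ⟨c t, t, rfl⟩, fun i => Set.rangeSplitting c (e.symm i),
    hc.mono fun n hn => (measure_mono ?_).trans hn⟩
  rintro ω ⟨t, ht⟩
  refine ⟨t, _, ?_, ht⟩
  simp [Set.apply_rangeSplitting]

variable [∀ n, IsProbabilityMeasure (Q n)] {Ω' : Type*} [MeasurableSpace Ω'] {P' : Measure Ω'}
  [IsProbabilityMeasure P'] {X : T → Ω' → ℝ}

/-- A bound on the increments of `W` over finitely many pairs passes to the limit in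
distribution. -/
lemma measure_exists_increment_le {ι : Type} [Fintype ι] {r : ι → T}
    (h : TendstoInDistribution (fun n ω i => W n ω (r i)) atTop (fun ω i => X (r i) ω) Q P')
    (R : Set (ι × ι)) {c : ℝ} {a : ℝ≥0∞}
    (hW : ∀ᶠ n in atTop, Q n {ω | ∃ p ∈ R, c < |W n ω (r p.1) - W n ω (r p.2)|} ≤ a) :
    P' {ω | ∃ p ∈ R, c < |X (r p.1) ω - X (r p.2) ω|} ≤ a := by
  let U : Set (ι → ℝ) := {y | ∃ p ∈ R, c < |y p.1 - y p.2|}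
  have hU : IsOpen U := by
    have : U = ⋃ p ∈ R, {y : ι → ℝ | c < |y p.1 - y p.2|} := by ext; simp [U]
    rw [this]
    exact isOpen_biUnion fun p _ => isOpen_lt continuous_const (by fun_prop)
  have h1 := ProbabilityMeasure.le_liminf_measure_open_of_tendsto h.tendsto hU
  simp only [ProbabilityMeasure.coe_mk] at h1
  rw [Measure.map_apply_of_aemeasurable h.aemeasurable_limit hU.measurableSet] at h1
  refine h1.trans (liminf_le_of_frequently_le' (Eventually.frequently ?_))
  filter_upwards [hW] with n hn
  rw [Measure.map_apply_of_aemeasurable (h.forall_aemeasurable n) hU.measurableSet]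
  exact hn

/-- Convergence in distribution, tested on a bounded continuous function. -/
lemma tendsto_integral_of_tendstoInDistribution {E : Type*} [TopologicalSpace E]
    [MeasurableSpace E] [OpensMeasurableSpace E] {Y : ∀ n, Ω n → E} {Y' : Ω' → E}
    (h : TendstoInDistribution Y atTop Y' Q P') (f : E →ᵇ ℝ) :
    Tendsto (fun n => ∫ ω, f (Y n ω) ∂Q n) atTop (𝓝 (∫ ω, f (Y' ω) ∂P')) := by
  have h1 := ProbabilityMeasure.tendsto_iff_forall_integral_tendsto.1 h.tendsto f
  simp only [ProbabilityMeasure.coe_mk] at h1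
  rw [integral_map h.aemeasurable_limit f.continuous.measurable.aestronglyMeasurable] at h1
  refine h1.congr fun n => ?_
  rw [integral_map (h.forall_aemeasurable n) f.continuous.measurable.aestronglyMeasurable]

lemma memlp_comp_fin {m : ℕ} (y : Fin m → ℝ) (c : T → Fin m) : Memℓp (fun t => y (c t)) ∞ := by
  refine memℓp_infty ⟨‖y‖, ?_⟩
  rintro _ ⟨t, rfl⟩
  exact norm_le_pi_norm y (c t)

lemma continuous_toLInf_comp {m : ℕ} (c : T → Fin m) :
    Continuous fun y : Fin m → ℝ => toLInf fun t => y (c t) := by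
  refine LipschitzWith.continuous (K := 1) (LipschitzWith.of_dist_le_mul fun y y' => ?_)
  rw [NNReal.coe_one, one_mul]
  exact dist_toLInf_le (memlp_comp_fin y c) (memlp_comp_fin y' c) dist_nonneg
    fun t => dist_le_pi_dist y y' (c t)

/-- The step processes `t ↦ X (r k (c k t))` are measurable into `ℓ^∞(T)` because they factor
through a finite-dimensional space. The portmanteau theorem transfers increment bounds from `W` to
`X`; Borel–Cantelli then makes the step processes almost surely Cauchy, and `Z` is their limit. Weak
convergence follows by comparing `W`, its step version, the step version of `X`, and `Z`. -/
theorem FiniteOscillation.exists_weak_limit (h : FiniteOscillation Q W)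
    (hb : ∀ n ω, Memℓp (W n ω) ∞) (hm : ∀ n t, Measurable fun ω => W n ω t)
    (hX : ∀ t, Measurable (X t))
    (hfd : ∀ (ι : Type) [Fintype ι] (r : ι → T),
      TendstoInDistribution (fun n ω i => W n ω (r i)) atTop (fun ω i => X (r i) ω) Q P') :
    ∃ Z : Ω' → LInf T, StronglyMeasurable Z ∧ (∀ t, ∀ᵐ ω ∂P', Z ω t = X t ω) ∧
      ConvergesWeakly Q W (P'.map Z) := by
  let e : ℕ → ℝ := fun k => (1 / 2) ^ k
  have he : ∀ k, 0 < e k := fun k => by positivity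
  have hes : Summable fun k => 2 * e k := summable_geometric_two.mul_left 2
  have he0 : Tendsto e atTop (𝓝 0) :=
    tendsto_pow_atTop_nhds_zero_of_lt_one (by norm_num) (by norm_num)
  choose m c r hcr using fun k => h.exists_approx (he k)
  let Y : ℕ → Ω' → LInf T := fun k ω => toLInf fun t => X (r k (c k t)) ω
  have hYmem : ∀ k ω, Memℓp (fun t => X (r k (c k t)) ω) ∞ := fun k ω =>
    memlp_comp_fin (fun i => X (r k i) ω) (c k)
  have hY : ∀ k, StronglyMeasurable (Y k) := fun k =>
    (continuous_toLInf_comp (c k)).stronglyMeasurable.comp_measurable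
      (measurable_pi_lambda _ fun i => hX (r k i))
  -- the approximations are almost surely a Cauchy sequence
  have hA : ∀ k, P' {ω | ∃ t, 2 * e k < |X (r k (c k t)) ω - X (r (k + 1) (c (k + 1) t)) ω|}
      ≤ ENNReal.ofReal (2 * e k) := by
    intro k
    -- Pairs of cells of levels `k` and `k + 1` that share an index. They form a finite set, so the
    -- event over all `t` concerns only finitely many coordinates.
    let R : Set ((Fin (m k) ⊕ Fin (m (k + 1))) × (Fin (m k) ⊕ Fin (m (k + 1)))) :=
      Set.range fun t => (Sum.inl (c k t), Sum.inr (c (k + 1) t))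
    have := measure_exists_increment_le (hfd _ (Sum.elim (r k) (r (k + 1)))) R (c := 2 * e k)
      (a := ENNReal.ofReal (2 * e k)) ?_
    · simpa [R] using this
    · filter_upwards [hcr k, hcr (k + 1)] with n hn hn'
      have hek : e (k + 1) = e k / 2 := by simp only [e, pow_succ]; ring
      calc _ ≤ Q n ({ω | ∃ t, e k < |W n ω t - W n ω (r k (c k t))|} ∪
            {ω | ∃ t, e (k + 1) < |W n ω t - W n ω (r (k + 1) (c (k + 1) t))|}) := by
            refine measure_mono ?_
            rintro ω ⟨_, ⟨t, rfl⟩, ht⟩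
            simp only [Sum.elim_inl, Sum.elim_inr] at ht
            by_contra hcon
            simp only [Set.mem_union, Set.mem_ofPred_eq, not_or, not_exists, not_lt] at hcon
            have h1 := abs_le.1 (hcon.1 t)
            have h2 := abs_le.1 (hcon.2 t)
            rw [hek] at h2
            have := he k
            rcases lt_abs.1 ht with h | h <;> linarith [h1.1, h1.2, h2.1, h2.2]
        _ ≤ ENNReal.ofReal (e k) + ENNReal.ofReal (e (k + 1)) :=
            (measure_union_le _ _).trans (add_le_add hn hn')
        _ ≤ ENNReal.ofReal (2 * e k) := by
            rw [← ENNReal.ofReal_add (he _).le (he _).le]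
            refine ENNReal.ofReal_le_ofReal ?_
            linarith [he k]
  have hlim : ∀ᵐ ω ∂P', ∃ z, Tendsto (fun k => Y k ω) atTop (𝓝 z) := by
    have hsum : ∑' k, P' {ω | ∃ t, 2 * e k <
        |X (r k (c k t)) ω - X (r (k + 1) (c (k + 1) t)) ω|} ≠ ∞ :=
      ne_top_of_le_ne_top hes.tsum_ofReal_ne_top (ENNReal.tsum_le_tsum hA)
    filter_upwards [ae_eventually_notMem hsum] with ω hω
    refine cauchySeq_tendsto_of_complete (cauchySeq_of_summable_dist ?_)
    refine Summable.of_norm_bounded_eventually_nat hes ?_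
    filter_upwards [hω] with k hk
    rw [Real.norm_of_nonneg dist_nonneg]
    exact dist_toLInf_le (hYmem k ω) (hYmem (k + 1) ω) (by have := he k; positivity)
      fun t => not_lt.1 fun hlt => hk ⟨t, hlt⟩
  obtain ⟨Z, hZ, hZlim⟩ := exists_stronglyMeasurable_limit_of_tendsto_ae
    (fun k => (hY k).aestronglyMeasurable) hlim
  refine ⟨Z, hZ, fun t => ?_, ?_⟩
  -- For fixed `t`, Borel–Cantelli shows that the step processes at `t` converge to `X t` as well as
  -- to `Z t`. The null set depends on `t`.
  · have hB : ∀ k, P' {ω | e k < |X t ω - X (r k (c k t)) ω|} ≤ ENNReal.ofReal (e k) := by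
      intro k
      have := measure_exists_increment_le (hfd _ ![t, r k (c k t)]) {(0, 1)} (c := e k)
        (a := ENNReal.ofReal (e k)) ?_
      · simpa using this
      · filter_upwards [hcr k] with n hn
        refine (measure_mono ?_).trans hn
        rintro ω ⟨_, rfl, ht⟩
        exact ⟨t, by simpa using ht⟩
    have hsum : ∑' k, P' {ω | e k < |X t ω - X (r k (c k t)) ω|} ≠ ∞ :=
      ne_top_of_le_ne_top summable_geometric_two.tsum_ofReal_ne_top (ENNReal.tsum_le_tsum hB)
    filter_upwards [ae_eventually_notMem hsum, hZlim] with ω hω hωZ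
    have h1 : Tendsto (fun k => X (r k (c k t)) ω) atTop (𝓝 (X t ω)) := by
      refine tendsto_iff_dist_tendsto_zero.2 (squeeze_zero' (Eventually.of_forall fun _ =>
        dist_nonneg) ?_ he0)
      filter_upwards [hω] with k hk
      rw [dist_comm, Real.dist_eq]
      exact not_lt.1 hk
    have h2 : Tendsto (fun k => X (r k (c k t)) ω) atTop (𝓝 (Z ω t)) := by
      refine tendsto_iff_dist_tendsto_zero.2 (squeeze_zero (fun _ => dist_nonneg)
        (fun k => ?_) (tendsto_iff_dist_tendsto_zero.1 hωZ))
      rw [Real.dist_eq, ← toLInf_apply (hYmem k ω) t]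
      exact abs_apply_sub_le_dist _ _ t
    exact tendsto_nhds_unique h2 h1
  · have : IsProbabilityMeasure (P'.map Z) :=
      Measure.isProbabilityMeasure_map hZ.measurable.aemeasurable
    refine convergesWeakly_of_lipschitz hb fun f K hf => ?_
    rw [integral_map hZ.measurable.aemeasurable f.continuous.measurable.aestronglyMeasurable]
    have hfY : Tendsto (fun k => ∫ ω, f (Y k ω) ∂P') atTop (𝓝 (∫ ω, f (Z ω) ∂P')) := by
      refine tendsto_integral_of_dominated_convergence (fun _ => ‖f‖)
        (fun k => (f.continuous.comp_stronglyMeasurable (hY k)).aestronglyMeasurable)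
        (integrable_const _) (fun k => Eventually.of_forall fun ω => f.norm_coe_le_norm _) ?_
      filter_upwards [hZlim] with ω hω
      exact (f.continuous.tendsto _).comp hω
    have hfW : ∀ k, Tendsto (fun n => outerExpectation (Q n)
        fun ω => f (toLInf fun t => W n ω (r k (c k t)))) atTop (𝓝 (∫ ω, f (Y k ω) ∂P')) := by
      intro k
      have h1 := tendsto_integral_of_tendstoInDistribution (hfd _ (r k))
        (f.compContinuous ⟨_, continuous_toLInf_comp (c k)⟩)
      refine h1.congr fun n => (outerExpectation_eq_integral ?_
        (fun ω => f.norm_coe_le_norm _)).symm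
      exact (f.continuous.comp (continuous_toLInf_comp (c k))).measurable.comp
        (measurable_pi_lambda _ fun i => hm n (r k i))
    refine Metric.tendsto_atTop'.2 fun ε hε => ?_
    have hCe : Tendsto (fun k => (K + 2 * ‖f‖) * e k) atTop (𝓝 0) := by
      simpa using he0.const_mul (K + 2 * ‖f‖)
    obtain ⟨k, hk1, hk2⟩ := ((hCe.eventually (gt_mem_nhds (show 0 < ε / 3 by positivity))).and
      (Metric.tendsto_nhds.1 hfY (ε / 3) (by positivity))).exists
    obtain ⟨N, hN⟩ := eventually_atTop.1 ((hcr k).and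
      (Metric.tendsto_nhds.1 (hfW k) (ε / 3) (by positivity)))
    refine ⟨N, fun n hn => ?_⟩
    obtain ⟨h1, h2⟩ := hN n hn.le
    have h3 := abs_outerExpectation_sub_le (hb n)
      (fun ω => memlp_comp_fin (fun i => W n ω (r k i)) (c k)) f hf (he k).le h1
    rw [← Real.dist_eq] at h3
    have h4 := dist_triangle4 (outerExpectation (Q n) fun ω => f (toLInf (W n ω)))
      (outerExpectation (Q n) fun ω => f (toLInf fun t => W n ω (r k (c k t))))
      (∫ ω, f (Y k ω) ∂P') (∫ ω, f (Z ω) ∂P')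
    linarith

/-- The law of a strongly measurable map into a complete metric space is tight. -/
lemma isTightMeasureSet_map_of_stronglyMeasurable {E : Type*} [MetricSpace E] [CompleteSpace E]
    [MeasurableSpace E] [BorelSpace E] {Z : Ω' → E} (hZ : StronglyMeasurable Z) :
    IsTightMeasureSet {P'.map Z} := by
  -- Strong measurability confines `Z` to a closed separable subspace, which is Polish, so the law
  -- is tight there; tightness is pushed forward along the inclusion.
  let S := closure (Set.range Z)
  have hS : TopologicalSpace.IsSeparable S := hZ.isSeparable_range.closure
  have : TopologicalSpace.SeparableSpace S := hS.separableSpace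
  have : SecondCountableTopology S := UniformSpace.secondCountable_of_separable S
  have : CompleteSpace S := isClosed_closure.completeSpace_coe
  let Z' : Ω' → S := fun ω => ⟨Z ω, subset_closure ⟨ω, rfl⟩⟩
  have hZ' : Measurable Z' := hZ.measurable.subtype_mk
  have h1 : IsTightMeasureSet {P'.map Z'} := isTightMeasureSet_singleton
  have h2 := h1.map (f := ((↑) : S → E)) continuous_subtype_val
  rwa [Set.image_singleton, Measure.map_map measurable_subtype_coe hZ'] at h2

end WeakLimit


/-! ### Isonormal Gaussian processes -/

section Isonormal

variable {Ω : Type*} [MeasurableSpace Ω] {P : Measure Ω}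

lemma norm_exp_mul_I_sub_exp_mul_I_le (x y : ℝ) :
    ‖Complex.exp (x * Complex.I) - Complex.exp (y * Complex.I)‖ ≤ |x - y| := by
  have h : Complex.exp (x * Complex.I) - Complex.exp (y * Complex.I) =
      Complex.exp (y * Complex.I) * (Complex.exp (Complex.I * (x - y : ℝ)) - 1) := by
    rw [mul_sub, ← Complex.exp_add, mul_one]
    push_cast
    ring_nf
  rw [h, norm_mul, Complex.norm_exp_ofReal_mul_I, one_mul]
  exact Real.norm_exp_I_mul_ofReal_sub_one_le

lemma charFun_map_one {g : Ω → ℝ} (hg : AEMeasurable g P) :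
    charFun (P.map g) 1 = ∫ ω, Complex.exp (g ω * Complex.I) ∂P := by
  rw [charFun_apply_real, integral_map hg (by fun_prop)]
  simp

/-- Since `x ↦ exp (i x)` is 1-Lipschitz and the `L₁` norm is at most the `L₂` norm, the map is
1-Lipschitz. This extends the Gaussian characteristic function from finite combinations of basis
vectors to the whole Hilbert space. -/
lemma continuous_charFun_one_Lp [IsProbabilityMeasure P] :
    Continuous fun g : Lp ℝ 2 P => charFun (P.map g) 1 := by
  have hint : ∀ g : Lp ℝ 2 P, Integrable (fun ω => Complex.exp (g ω * Complex.I)) P := fun g =>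
    Integrable.of_bound (C := 1) (by
      have : AEStronglyMeasurable g P := Lp.aestronglyMeasurable g
      have hc : Continuous fun x : ℝ => Complex.exp (x * Complex.I) := by fun_prop
      exact hc.comp_aestronglyMeasurable this) (Eventually.of_forall fun ω => (Complex.norm_exp_ofReal_mul_I _).le)
  refine LipschitzWith.continuous (K := 1) (LipschitzWith.of_dist_le_mul fun g g' => ?_)
  rw [charFun_map_one (Lp.aestronglyMeasurable g).aemeasurable,
    charFun_map_one (Lp.aestronglyMeasurable g').aemeasurable, dist_eq_norm, dist_eq_norm,
    ← integral_sub (hint g) (hint g'), NNReal.coe_one, one_mul]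
  refine (norm_integral_le_lintegral_norm _).trans ?_
  rw [Lp.norm_def]
  refine ENNReal.toReal_mono (Lp.eLpNorm_ne_top _) ?_
  refine le_trans ?_ (eLpNorm_le_eLpNorm_of_exponent_le (p := 1) (by norm_num)
    (Lp.aestronglyMeasurable _))
  rw [eLpNorm_one_eq_lintegral_enorm]
  refine lintegral_mono_ae ?_
  filter_upwards [Lp.coeFn_sub g g'] with ω hω
  rw [hω, ofReal_norm]
  exact enorm_le_iff_norm_le.2 (norm_exp_mul_I_sub_exp_mul_I_le _ _)

/-- Every real Hilbert space carries an isonormal Gaussian process. -/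
theorem exists_isonormal (H : Type*) [NormedAddCommGroup H] [InnerProductSpace ℝ H]
    [CompleteSpace H] :
    ∃ (w : Set H) (P : Measure (w → ℝ)) (_ : IsProbabilityMeasure P) (L : H →ₗᵢ[ℝ] Lp ℝ 2 P),
      ∀ f, P.map (L f) = gaussianReal 0 (‖f‖₊ ^ 2) := by
  obtain ⟨w, b, -⟩ := exists_hilbertBasis ℝ H
  let P : Measure (w → ℝ) := Measure.infinitePi fun _ => gaussianReal 0 1
  have hlaw : ∀ i : w, P.map (fun ω => ω i) = gaussianReal 0 1 := fun i =>
    Measure.infinitePi_map_eval (fun _ => gaussianReal 0 1) i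
  have hm : ∀ i : w, AEMeasurable (fun ω : w → ℝ => ω i) P := fun i =>
    (measurable_pi_apply i).aemeasurable
  have hmem : ∀ i : w, MemLp (fun ω : w → ℝ => ω i) 2 P := by
    intro i
    have h := memLp_id_gaussianReal (μ := 0) (v := 1) 2
    rw [← hlaw i] at h
    exact (memLp_map_measure_iff (by fun_prop) (hm i)).1 h
  have hmean : ∀ i : w, ∫ ω, ω i ∂P = 0 := by
    intro i
    have h := integral_id_gaussianReal (μ := 0) (v := 1)
    rw [← hlaw i] at h
    rwa [integral_map (hm i) (by fun_prop)] at h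
  have hindep : iIndepFun (fun (i : w) ω => ω i) P :=
    iIndepFun_infinitePi (X := fun _ x => x) fun _ => measurable_id
  let v : w → Lp ℝ 2 P := fun i => (hmem i).toLp _
  have hinner : ∀ i j, inner ℝ (v i) (v j) = ∫ ω, ω j * ω i ∂P := by
    intro i j
    rw [L2.inner_def]
    refine integral_congr_ae ?_
    filter_upwards [(hmem i).coeFn_toLp, (hmem j).coeFn_toLp] with ω h1 h2
    rw [h1, h2]
    simp
  have hv : Orthonormal ℝ v := by
    classical
    rw [orthonormal_iff_ite]
    intro i j
    rw [hinner]
    split_ifs with hij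
    · subst hij
      have h := variance_id_gaussianReal (μ := 0) (v := 1)
      rw [← hlaw i, variance_map (by fun_prop) (hm i), Function.id_comp,
        variance_of_integral_eq_zero (hm i) (hmean i)] at h
      simpa [sq] using h
    · have := (hindep.indepFun hij).integral_fun_mul_eq_mul_integral (hmem i).1 (hmem j).1
      simp only [hmean, mul_zero] at this
      simpa [mul_comm] using this
  -- A Hilbert basis is sent to the independent standard normal coordinates, which are orthonormal
  -- in `L₂(P)`.
  let L : H →ₗᵢ[ℝ] Lp ℝ 2 P :=
    hv.orthogonalFamily.linearIsometry.comp b.repr.toLinearIsometry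
  refine ⟨w, P, inferInstance, L, ?_⟩
  have hb : ∀ i, L (b i) = v i := by
    classical
    intro i
    simp [L, b.repr_self]
  -- the characteristic functions on the span of the basis
  have hfin : ∀ (s : Finset w) (a : w → ℝ), charFun (P.map (L (∑ i ∈ s, a i • b i))) 1 =
      Complex.exp (-((‖∑ i ∈ s, a i • b i‖ ^ 2 : ℝ) : ℂ) / 2) := by
    intro s a
    have h1 : (L (∑ i ∈ s, a i • b i) : (w → ℝ) → ℝ) =ᵐ[P] fun ω => ∑ i ∈ s, a i * ω i := by
      simp only [map_sum, map_smul, hb]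
      refine (Lp.coeFn_fun_finsetSum s _).trans ?_
      have : ∀ i ∈ s, ∀ᵐ ω ∂P, (a i • v i) ω = a i * ω i := by
        intro i _
        filter_upwards [Lp.coeFn_smul (a i) (v i), (hmem i).coeFn_toLp] with ω h1 h2
        rw [h1, Pi.smul_apply, h2, smul_eq_mul]
      filter_upwards [(Finset.eventually_all s).2 this] with ω hω
      exact Finset.sum_congr rfl hω
    have h2 : iIndepFun (fun (i : w) (ω : w → ℝ) => a i * ω i) P :=
      iIndepFun_infinitePi (X := fun i x => a i * x) fun i => by fun_prop
    rw [Measure.map_congr h1, iIndepFun.charFun_map_fun_finsetSum_eq_prod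
      (X := fun (i : w) (ω : w → ℝ) => a i * ω i) (fun i _ => (hm i).const_mul _) (h2.restrict _),
      Finset.prod_apply]
    have h3 : ∀ i, charFun (P.map fun ω => a i * ω i) 1 =
        Complex.exp (-((a i ^ 2 : ℝ) : ℂ) / 2) := by
      intro i
      rw [charFun_map_mul_comp (hm i), hlaw, charFun_gaussianReal]
      congr 1
      push_cast
      ring
    simp only [h3]
    rw [← Complex.exp_sum]
    congr 1
    rw [← Finset.sum_div, ← real_inner_self_eq_norm_sq, b.orthonormal.inner_sum]
    push_cast
    rw [Finset.sum_neg_distrib]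
    simp [sq]
  have hall : ∀ f, charFun (P.map (L f)) 1 = Complex.exp (-((‖f‖ ^ 2 : ℝ) : ℂ) / 2) := by
    intro f
    have h1 : Tendsto (fun s : Finset w => ∑ i ∈ s, b.repr f i • b i) atTop (𝓝 f) :=
      b.hasSum_repr f
    have h2 := (continuous_charFun_one_Lp (P := P).comp L.continuous).tendsto f |>.comp h1
    have h3 := (by fun_prop : Continuous fun g : H =>
      Complex.exp (-((‖g‖ ^ 2 : ℝ) : ℂ) / 2)).tendsto f |>.comp h1
    refine tendsto_nhds_unique h2 (h3.congr fun s => ?_)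
    exact (hfin s _).symm
  intro f
  have hLf : ∀ f, AEMeasurable (L f) P := fun f => (Lp.aestronglyMeasurable _).aemeasurable
  have := Measure.isProbabilityMeasure_map (hLf f)
  refine Measure.ext_of_charFun (funext fun t => ?_)
  -- By linearity of `L`, the value at `1` for all vectors determines the whole characteristic
  -- function.
  have h1 : charFun (P.map (L f)) t = charFun (P.map (L (t • f))) 1 := by
    have : (L (t • f) : (w → ℝ) → ℝ) =ᵐ[P] fun ω => t * L f ω := by
      rw [map_smul]
      exact Lp.coeFn_smul t (L f)
    rw [Measure.map_congr this, charFun_map_mul_comp (hLf f), mul_one]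
  rw [h1, hall, charFun_gaussianReal, norm_smul]
  congr 1
  push_cast
  rw [mul_pow, ← Complex.ofReal_pow, Real.norm_eq_abs, sq_abs]
  push_cast
  ring

end Isonormal


/-! ### Norms and linear combinations in `L₂` -/

section LTwo

lemma lp_norm_sq_eq {𝓧 : Type*} [MeasurableSpace 𝓧] {P : Measure 𝓧} {g : 𝓧 → ℝ} (hg : MemLp g 2 P) :
    ‖hg.toLp g‖ ^ 2 = ∫ x, g x ^ 2 ∂P := by
  rw [← real_inner_self_eq_norm_sq, L2.inner_def]
  refine integral_congr_ae ?_
  filter_upwards [hg.coeFn_toLp] with x hx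
  rw [hx]
  simp [sq]

/-- Linear combinations of an isonormal process are Gaussian. -/
lemma map_sum_isonormal {H Ω : Type*} [NormedAddCommGroup H] [InnerProductSpace ℝ H]
    [MeasurableSpace Ω] {P : Measure Ω} {L : H →ₗᵢ[ℝ] Lp ℝ 2 P}
    (hL : ∀ f, P.map (L f) = gaussianReal 0 (‖f‖₊ ^ 2)) {ι : Type*} [Fintype ι] (F : ι → H)
    (u : ι → ℝ) :
    P.map (fun ω => ∑ i, u i * L (F i) ω) = gaussianReal 0 (‖∑ i, u i • F i‖₊ ^ 2) := by
  rw [← hL]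
  refine Measure.map_congr ?_
  simp only [map_sum, map_smul]
  refine EventuallyEq.symm ((Lp.coeFn_fun_finsetSum _ _).trans ?_)
  have : ∀ i : ι, ∀ᵐ ω ∂P, (u i • L (F i)) ω = u i * L (F i) ω := fun i =>
    Lp.coeFn_smul (u i) (L (F i))
  filter_upwards [eventually_all.2 this] with ω hω
  exact Finset.sum_congr rfl fun i _ => hω i

end LTwo

/-! ### Central limit theorem and Gaussian limit in `ℓ^∞` -/

section CentralLimit

variable {𝓧 : Type*} [MeasurableSpace 𝓧] {P : Measure 𝓧} [IsProbabilityMeasure P]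

instance instIsProbabilityMeasureSampleLaw (n : ℕ) : IsProbabilityMeasure (sampleLaw P n) := by
  unfold sampleLaw
  infer_instance

lemma charFun_sampleLaw_sum {g : 𝓧 → ℝ} (hg : Measurable g) (n : ℕ) (t : ℝ) :
    charFun ((sampleLaw P n).map fun x => (√(n : ℝ))⁻¹ * ∑ i, g (x i)) t =
      charFun (P.map g) ((√(n : ℝ))⁻¹ * t) ^ n := by
  have hind : iIndepFun (fun (i : Fin n) (x : Fin n → 𝓧) => g (x i)) (sampleLaw P n) :=
    iIndepFun_pi (X := fun _ => g) fun _ => hg.aemeasurable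
  have hm : ∀ i, Measurable fun x : Fin n → 𝓧 => g (x i) := fun i =>
    hg.comp (measurable_pi_apply i)
  rw [charFun_map_mul_comp (Finset.measurable_fun_sum _ fun i _ => hm i).aemeasurable,
    hind.charFun_map_fun_sum_eq_prod fun i => (hm i).aemeasurable, Finset.prod_apply]
  have : ∀ i : Fin n, (sampleLaw P n).map (fun x => g (x i)) = P.map g := by
    intro i
    have h := Measure.map_map (μ := sampleLaw P n) hg (measurable_pi_apply i)
    rw [sampleLaw, (measurePreserving_eval (fun _ : Fin n => P) i).map_eq] at h
    exact h.symm
  simp [this]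

lemma tendsto_charFun_sampleLaw_sum {g : 𝓧 → ℝ} (hg : Measurable g) (hg2 : MemLp g 2 P)
    (h0 : ∫ x, g x ∂P = 0) :
    Tendsto (fun n : ℕ => charFun ((sampleLaw P n).map fun x => (√(n : ℝ))⁻¹ * ∑ i, g (x i)) 1)
      atTop (𝓝 (Complex.exp (-((∫ x, g x ^ 2 ∂P : ℝ) : ℂ) / 2))) := by
  simp only [charFun_sampleLaw_sum hg, mul_one]
  -- The scalar central limit theorem is for unit variance: it is applied to `g / √v` at the
  -- argument `√v`, and zero variance is handled separately.
  rcases (integral_nonneg fun x => sq_nonneg (g x) : 0 ≤ ∫ x, g x ^ 2 ∂P).eq_or_lt with hv | hv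
  · have hg0 : g =ᵐ[P] fun _ => 0 := by
      have := (integral_eq_zero_iff_of_nonneg (fun x => sq_nonneg (g x))
        hg2.integrable_sq).1 hv.symm
      filter_upwards [this] with x hx
      simpa using hx
    rw [Measure.map_congr hg0, ← hv]
    simp [charFun_dirac]
  · set v := ∫ x, g x ^ 2 ∂P
    have hs : 0 < √v := Real.sqrt_pos.2 hv
    have h1 := tendsto_charFun_inv_sqrt_mul_pow (P := P) (X := fun x => (√v)⁻¹ * g x)
      (by fun_prop) (by rw [integral_const_mul, h0, mul_zero]) (by
        simp only [Pi.pow_apply, mul_pow]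
        rw [integral_const_mul, inv_pow, Real.sq_sqrt hv.le, inv_mul_cancel₀ hv.ne']) (√v)
    rw [← Complex.ofReal_pow, Real.sq_sqrt hv.le] at h1
    refine h1.congr fun n => ?_
    rw [charFun_map_mul_comp (by fun_prop)]
    congr 2
    field_simp

/-- The Cramér–Wold device: convergence of vectors reduces to scalar linear combinations, for which
both the central limit theorem and the isonormal law are available. -/
lemma charFun_toLp_eq {Ω ι : Type*} [MeasurableSpace Ω] [Fintype ι] {Q : Measure Ω} {V : ι → Ω → ℝ}
    (hV : ∀ i, Measurable (V i)) (u : EuclideanSpace ℝ ι) :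
    charFun (Q.map fun ω => WithLp.toLp 2 fun i => V i ω) u =
      charFun (Q.map fun ω => ∑ i, u i * V i ω) 1 := by
  rw [charFun_map_one (by fun_prop), charFun_apply, integral_map (by fun_prop) (by fun_prop)]
  simp [PiLp.inner_apply]

variable {T : Type*} {f : T → 𝓧 → ℝ}

lemma continuous_lInf_eval (t : T) : Continuous fun z : LInf T => z t := by
  refine LipschitzWith.continuous (K := 1) (LipschitzWith.of_dist_le_mul fun z z' => ?_)
  rw [NNReal.coe_one, one_mul]
  exact abs_apply_sub_le_dist z z' t

/-- A normalized sum process with finite oscillation converges weakly to a tight Gaussian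
process. -/
theorem exists_gaussian_limit (hf : ∀ t, Measurable (f t)) (hf2 : ∀ t, MemLp (f t) 2 P)
    (hf0 : ∀ t, ∫ x, f t x ∂P = 0)
    (hb : ∀ (n : ℕ) (x : Fin n → 𝓧), Memℓp (fun t => (√(n : ℝ))⁻¹ * ∑ i, f t (x i)) ∞)
    (hosc : FiniteOscillation (sampleLaw P) fun (n : ℕ) x t => (√(n : ℝ))⁻¹ * ∑ i, f t (x i)) :
    ∃ ν : Measure (LInf T), IsTightCenteredGaussian ν (fun s t => ∫ x, f s x * f t x ∂P) ∧
      ConvergesWeakly (sampleLaw P) (fun (n : ℕ) x t => (√(n : ℝ))⁻¹ * ∑ i, f t (x i)) ν := by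
  obtain ⟨w, P', hP', L, hL⟩ := exists_isonormal (Lp ℝ 2 P)
  let F : T → Lp ℝ 2 P := fun t => (hf2 t).toLp (f t)
  let X : T → (w → ℝ) → ℝ := fun t => L (F t)
  have hX : ∀ t, Measurable (X t) := fun t => (Lp.stronglyMeasurable _).measurable
  have hcomb : ∀ (ι : Type) [Fintype ι] (r : ι → T) (u : ι → ℝ),
      P'.map (fun ω => ∑ i, u i * X (r i) ω) =
        gaussianReal 0 (‖∑ i, u i • F (r i)‖₊ ^ 2) := fun ι _ r u =>
    map_sum_isonormal hL (fun i => F (r i)) u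
  have hnorm : ∀ (ι : Type) [Fintype ι] (r : ι → T) (u : ι → ℝ),
      ‖∑ i, u i • F (r i)‖ ^ 2 = ∫ x, (∑ i, u i * f (r i) x) ^ 2 ∂P := by
    intro ι _ r u
    have hmem : MemLp (fun x => ∑ i, u i * f (r i) x) 2 P :=
      memLp_finsetSum _ fun i _ => (hf2 (r i)).const_mul (u i)
    have : ∑ i, u i • F (r i) = hmem.toLp _ := by
      refine Lp.ext ((Lp.coeFn_fun_finsetSum _ _).trans ?_)
      have : ∀ i : ι, ∀ᵐ x ∂P, (u i • F (r i)) x = u i * f (r i) x := by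
        intro i
        filter_upwards [Lp.coeFn_smul (u i) (F (r i)), (hf2 (r i)).coeFn_toLp] with x h1 h2
        rw [h1, Pi.smul_apply, h2, smul_eq_mul]
      filter_upwards [eventually_all.2 this, hmem.coeFn_toLp] with x hx h2
      rw [h2]
      exact Finset.sum_congr rfl fun i _ => hx i
    rw [this, lp_norm_sq_eq]
  have hfd : ∀ (ι : Type) [Fintype ι] (r : ι → T),
      TendstoInDistribution (fun (n : ℕ) x i => (√(n : ℝ))⁻¹ * ∑ j, f (r i) (x j)) atTop
        (fun ω i => X (r i) ω) (sampleLaw P) P' := by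
    intro ι _ r
    have hmeas : ∀ (n : ℕ) (i : ι),
        Measurable fun x : Fin n → 𝓧 => (√(n : ℝ))⁻¹ * ∑ j, f (r i) (x j) := by
      intro n i
      have := hf (r i)
      fun_prop
    have h : TendstoInDistribution
        (fun (n : ℕ) x => WithLp.toLp 2 fun i => (√(n : ℝ))⁻¹ * ∑ j, f (r i) (x j)) atTop
        (fun ω => WithLp.toLp 2 fun i => X (r i) ω) (sampleLaw P) P' := by
      refine ⟨fun n => ?_, by fun_prop,
        ProbabilityMeasure.tendsto_iff_tendsto_charFun.2 fun u => ?_⟩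
      · exact ((WithLp.measurable_toLp 2 _).comp
          (measurable_pi_lambda _ fun i => hmeas n i)).aemeasurable
      simp only [ProbabilityMeasure.coe_mk]
      rw [charFun_toLp_eq (fun i => hX (r i)), hcomb, charFun_gaussianReal]
      have hg : Measurable fun x => ∑ i, u i * f (r i) x :=
        Finset.measurable_fun_sum _ fun i _ => (hf (r i)).const_mul _
      have hg2 : MemLp (fun x => ∑ i, u i * f (r i) x) 2 P :=
        memLp_finsetSum _ fun i _ => (hf2 (r i)).const_mul (u i)
      have hg0 : ∫ x, ∑ i, u i * f (r i) x ∂P = 0 := by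
        rw [integral_finsetSum _ fun i _ =>
          ((hf2 (r i)).const_mul (u i)).integrable one_le_two]
        simp [integral_const_mul, hf0]
      have h1 := tendsto_charFun_sampleLaw_sum hg hg2 hg0
      rw [← hnorm] at h1
      convert h1 using 2 with n
      · rw [charFun_toLp_eq (hmeas n)]
        congr 3
        ext x
        simp only [Finset.mul_sum]
        rw [Finset.sum_comm]
        refine Finset.sum_congr rfl fun i _ => Finset.sum_congr rfl fun j _ => by ring
      · congr 1
        push_cast
        ring
    exact h.continuous_comp (g := fun y i => y i) (by fun_prop)
  obtain ⟨Z, hZ, hZX, hZlim⟩ := hosc.exists_weak_limit hb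
    (fun n t => by have := hf t; fun_prop) hX hfd
  have hZm := hZ.measurable
  have hev : ∀ t, Measurable fun z : LInf T => z t := fun t => (continuous_lInf_eval t).measurable
  have hXg : IsGaussianProcess X P' := by
    refine ⟨fun I => ⟨isGaussian_of_map_eq_gaussianReal fun K => ?_⟩⟩
    have hIm : Measurable fun ω => I.restrict (X · ω) :=
      measurable_pi_lambda _ fun i => hX i
    rw [Measure.map_map K.continuous.measurable hIm]
    classical
    refine ⟨0, ‖∑ i : I, K (Pi.single i 1) • F i‖₊ ^ 2, ?_⟩
    convert map_sum_isonormal hL (fun i : I => F i) (fun i => K (Pi.single i 1)) using 2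
    ext ω
    refine (K.toLinearMap.pi_apply_eq_sum_univ _).trans (Finset.sum_congr rfl fun i _ => ?_)
    rw [smul_eq_mul, mul_comm]
    have : (fun j => if i = j then (1 : ℝ) else 0) = Pi.single i 1 := by
      ext j
      simp [Pi.single_apply, eq_comm]
    rw [this]
    rfl
  have hZg := hXg.congr fun t => (hZX t).mono fun ω h => h.symm
  have hZ0 : ∀ t, ∫ ω, Z ω t ∂P' = 0 := by
    intro t
    rw [integral_congr_ae (hZX t)]
    have h := integral_id_gaussianReal (μ := 0) (v := ‖F t‖₊ ^ 2)
    rw [← hL] at h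
    rwa [integral_map (hX t).aemeasurable (by fun_prop)] at h
  have hX2 : ∀ t, MemLp (X t) 2 P' := fun t => Lp.memLp _
  refine ⟨P'.map Z, ⟨Measure.isProbabilityMeasure_map hZm.aemeasurable,
    isTightMeasureSet_map_of_stronglyMeasurable hZ, ⟨fun I => ⟨?_⟩⟩, fun t => ?_, fun s t => ?_⟩,
    hZlim⟩
  · have hIm : Measurable fun z : LInf T => I.restrict fun t => z t :=
      measurable_pi_lambda _ fun i => hev i
    rw [Measure.map_map hIm hZm]
    exact (hZg.hasGaussianLaw I).isGaussian_map
  · rw [integral_map hZm.aemeasurable (hev t).aestronglyMeasurable]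
    exact hZ0 t
  · rw [covariance_map (hev s).aestronglyMeasurable (hev t).aestronglyMeasurable hZm.aemeasurable]
    have : cov[(fun z : LInf T => z s) ∘ Z, (fun z : LInf T => z t) ∘ Z; P'] =
        ∫ ω, X s ω * X t ω ∂P' := by
      rw [covariance]
      simp only [Function.comp_apply, hZ0, sub_zero]
      refine integral_congr_ae ?_
      filter_upwards [hZX s, hZX t] with ω h1 h2
      rw [h1, h2]
    rw [this]
    -- The covariance of the limit is an inner product of images under the isometry `L`, hence the
    -- inner product of the summands in `L₂(P)`.
    have h1 := L.inner_map_map (F t) (F s)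
    rw [L2.inner_def, L2.inner_def] at h1
    simp only [RCLike.inner_apply, conj_trivial] at h1
    refine h1.trans (integral_congr_ae ?_)
    filter_upwards [(hf2 s).coeFn_toLp, (hf2 t).coeFn_toLp] with x h1 h2
    rw [h1, h2]

end CentralLimit


/-! ### Root densities and differentiability in quadratic mean -/

section Model

lemma toReal_eLpNorm_sq_eq {𝓧 : Type*} [MeasurableSpace 𝓧] {μ : Measure 𝓧} {g : 𝓧 → ℝ}
    (hg : MemLp g 2 μ) : (eLpNorm g 2 μ).toReal ^ 2 = ∫ x, g x ^ 2 ∂μ := by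
  rw [← Lp.norm_toLp g hg, lp_norm_sq_eq]

lemma integrable_mul_of_memLp_two {𝓧 : Type*} [MeasurableSpace 𝓧] {μ : Measure 𝓧} {f g : 𝓧 → ℝ}
    (hf : MemLp f 2 μ) (hg : MemLp g 2 μ) : Integrable (fun x => f x * g x) μ :=
  hf.integrable_mul hg

/-- The Cauchy-Schwarz inequality for integrals. -/
lemma abs_integral_mul_le {𝓧 : Type*} [MeasurableSpace 𝓧] {μ : Measure 𝓧} {f g : 𝓧 → ℝ}
    (hf : MemLp f 2 μ) (hg : MemLp g 2 μ) {a b : ℝ} (ha : 0 ≤ a) (hb : 0 ≤ b)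
    (hfa : ∫ x, f x ^ 2 ∂μ ≤ a ^ 2) (hgb : ∫ x, g x ^ 2 ∂μ ≤ b ^ 2) :
    |∫ x, f x * g x ∂μ| ≤ a * b := by
  have h1 : ∫ x, f x * g x ∂μ = inner ℝ (hf.toLp f) (hg.toLp g) := by
    rw [L2.inner_def]
    refine integral_congr_ae ?_
    filter_upwards [hf.coeFn_toLp, hg.coeFn_toLp] with x h1 h2
    rw [h1, h2]
    simp [mul_comm]
  rw [h1]
  refine (abs_real_inner_le_norm _ _).trans ?_
  rw [← lp_norm_sq_eq hf] at hfa
  rw [← lp_norm_sq_eq hg] at hgb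
  exact mul_le_mul (abs_le_of_sq_le_sq' hfa ha).2 (abs_le_of_sq_le_sq' hgb hb).2
    (norm_nonneg _) ha

/-- Tests a local first-order estimate along a prescribed direction: openness of `Θ` provides
parameters on the ray from `θ₀` along `u`. The `+ 1` in the denominator covers `u = 0`. -/
lemma exists_shift_mem {E : Type*} [NormedAddCommGroup E] [NormedSpace ℝ E] {Θ : Set E}
    (hΘ : IsOpen Θ) {θ₀ : Θ} {p : Θ → Prop} (hp : ∀ᶠ θ in 𝓝 θ₀, p θ) (u : E) :
    ∃ t : ℝ, 0 < t ∧ ∃ θ : Θ, p θ ∧ (θ : E) - θ₀ = t • u := by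
  obtain ⟨δ, hδ, hpδ⟩ := Metric.eventually_nhds_iff.1 hp
  obtain ⟨δ', hδ', hball⟩ := Metric.isOpen_iff.1 hΘ θ₀ θ₀.2
  have hpos : 0 < min δ δ' / 2 / (‖u‖ + 1) := by positivity
  have hlt : dist ((θ₀ : E) + (min δ δ' / 2 / (‖u‖ + 1)) • u) θ₀ < min δ δ' := by
    rw [dist_self_add_left, norm_smul, Real.norm_of_nonneg hpos.le, div_mul_eq_mul_div,
      div_lt_iff₀ (by positivity)]
    have : 0 < min δ δ' := by positivity
    nlinarith [norm_nonneg u]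
  refine ⟨_, hpos, ⟨_, hball (Metric.mem_ball.2 (hlt.trans_le (min_le_right _ _)))⟩, hpδ ?_, ?_⟩
  · exact hlt.trans_le (min_le_left _ _)
  · simp

variable {𝓧 : Type*} [MeasurableSpace 𝓧] {d : ℕ} {Θ : Set (EuclideanSpace ℝ (Fin d))}
  {μ : Measure 𝓧} {P : Θ → Measure 𝓧} {sdot : Θ → 𝓧 → EuclideanSpace ℝ (Fin d)}

lemma measurable_rootDensity (θ : Θ) : Measurable (rootDensity μ P θ) :=
  ((Measure.measurable_rnDeriv _ _).ennreal_toReal).sqrt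

lemma rootDensity_nonneg (θ : Θ) (x : 𝓧) : 0 ≤ rootDensity μ P θ x := Real.sqrt_nonneg _

lemma rootDensity_sq (θ : Θ) (x : 𝓧) :
    rootDensity μ P θ x ^ 2 = ((P θ).rnDeriv μ x).toReal :=
  Real.sq_sqrt ENNReal.toReal_nonneg

namespace IsRegularParametric

variable (hmodel : IsRegularParametric μ P sdot)
include hmodel

lemma integral_eq {F : Type*} [NormedAddCommGroup F] [NormedSpace ℝ F] (θ : Θ) (g : 𝓧 → F) :
    ∫ x, g x ∂(P θ) = ∫ x, rootDensity μ P θ x ^ 2 • g x ∂μ := by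
  have := hmodel.sigmaFinite
  have := hmodel.isProbabilityMeasure θ
  simp only [rootDensity_sq]
  exact (integral_rnDeriv_smul (hmodel.dominated θ)).symm

lemma integrable_iff {F : Type*} [NormedAddCommGroup F] [NormedSpace ℝ F] (θ : Θ) (g : 𝓧 → F) :
    Integrable g (P θ) ↔ Integrable (fun x => rootDensity μ P θ x ^ 2 • g x) μ := by
  have := hmodel.sigmaFinite
  have := hmodel.isProbabilityMeasure θ
  simp only [rootDensity_sq]
  exact (integrable_rnDeriv_smul_iff (hmodel.dominated θ)).symm

lemma memLp_rootDensity (θ : Θ) : MemLp (rootDensity μ P θ) 2 μ := by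
  have := hmodel.isProbabilityMeasure θ
  refine (memLp_two_iff_integrable_sq (measurable_rootDensity θ).aestronglyMeasurable).2 ?_
  simpa using (hmodel.integrable_iff θ fun _ => (1 : ℝ)).1 (integrable_const 1)

lemma integral_rootDensity_sq (θ : Θ) : ∫ x, rootDensity μ P θ x ^ 2 ∂μ = 1 := by
  have := hmodel.isProbabilityMeasure θ
  simpa using (hmodel.integral_eq θ fun _ => (1 : ℝ)).symm

lemma memLp_inner_sdot (θ : Θ) (u : EuclideanSpace ℝ (Fin d)) :
    MemLp (fun x => inner ℝ (sdot θ x) u) 2 μ :=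
  (hmodel.memLp_sdot θ).inner_const u

lemma memLp_remainder (θ₀ θ : Θ) (u : EuclideanSpace ℝ (Fin d)) :
    MemLp (fun x => rootDensity μ P θ x - rootDensity μ P θ₀ x - inner ℝ (sdot θ₀ x) u) 2 μ :=
  ((hmodel.memLp_rootDensity θ).sub (hmodel.memLp_rootDensity θ₀)).sub
    (hmodel.memLp_inner_sdot θ₀ u)

lemma eventually_integral_remainder_sq_le (θ₀ : Θ) {ε : ℝ} (hε : 0 < ε) :
    ∀ᶠ θ : Θ in 𝓝 θ₀, ∫ x, (rootDensity μ P θ x - rootDensity μ P θ₀ x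
        - inner ℝ (sdot θ₀ x) ((θ : EuclideanSpace ℝ (Fin d)) - θ₀)) ^ 2 ∂μ
      ≤ (ε * ‖(θ : EuclideanSpace ℝ (Fin d)) - θ₀‖) ^ 2 := by
  filter_upwards [(hmodel.differentiable θ₀).bound hε] with θ hθ
  rw [← toReal_eLpNorm_sq_eq (hmodel.memLp_remainder θ₀ θ _)]
  rw [Real.norm_of_nonneg ENNReal.toReal_nonneg, norm_norm] at hθ
  exact pow_le_pow_left₀ ENNReal.toReal_nonneg hθ 2

/-- The derivative of the root density vanishes almost everywhere on the zeros of the density. -/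
lemma sdot_eq_zero (θ₀ : Θ) : ∀ᵐ x ∂μ, rootDensity μ P θ₀ x = 0 → sdot θ₀ x = 0 := by
  have key : ∀ u : EuclideanSpace ℝ (Fin d),
      ∀ᵐ x ∂μ, rootDensity μ P θ₀ x = 0 → 0 ≤ inner ℝ (sdot θ₀ x) u := by
    intro u
    let A : Set 𝓧 := {x | rootDensity μ P θ₀ x = 0}
    have hA : MeasurableSet A := measurable_rootDensity θ₀ (measurableSet_singleton 0)
    -- The negative part of the directional derivative on the zeros of `s(θ₀)`. There `s(θ) ≥ 0`, so
    -- at `θ = θ₀ + t u` the remainder dominates `t |g|`; since it is `o(t)` in `L₂`, `g` vanishes.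
    -- Using `u` and `-u` then kills the derivative.
    let g : 𝓧 → ℝ := A.indicator fun x => min (inner ℝ (sdot θ₀ x) u) 0
    have hD := hmodel.memLp_inner_sdot θ₀ u
    have hg : MemLp g 2 μ := by
      refine MemLp.indicator hA (hD.mono ?_ ?_)
      · exact hD.1.aemeasurable.min aemeasurable_const |>.aestronglyMeasurable
      · refine Eventually.of_forall fun x => ?_
        rw [Real.norm_eq_abs, Real.norm_eq_abs]
        rcases le_total (inner ℝ (sdot θ₀ x) u) 0 with h | h <;> simp [h]
    have hle : ∀ ε : ℝ, 0 < ε → ∫ x, g x ^ 2 ∂μ ≤ (ε * ‖u‖) ^ 2 := by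
      intro ε hε
      obtain ⟨t, ht, θ, hθ, htu⟩ := exists_shift_mem hmodel.isOpen
        (hmodel.eventually_integral_remainder_sq_le θ₀ hε) u
      rw [htu, norm_smul, Real.norm_of_nonneg ht.le] at hθ
      have h1 : ∫ x, (t * g x) ^ 2 ∂μ ≤ ∫ x, (rootDensity μ P θ x - rootDensity μ P θ₀ x
          - inner ℝ (sdot θ₀ x) (t • u)) ^ 2 ∂μ := by
        refine integral_mono (hg.const_mul t).integrable_sq
          (hmodel.memLp_remainder θ₀ θ _).integrable_sq fun x => ?_
        by_cases hx : x ∈ A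
        · have hx0 : rootDensity μ P θ₀ x = 0 := hx
          simp only [g, Set.indicator_of_mem hx, hx0, inner_smul_right]
          have := rootDensity_nonneg (μ := μ) (P := P) θ x
          rcases le_total (inner ℝ (sdot θ₀ x) u) 0 with h | h
          · rw [min_eq_left h]
            have : 0 ≤ -(t * inner ℝ (sdot θ₀ x) u) := by nlinarith
            nlinarith
          · rw [min_eq_right h]
            nlinarith [sq_nonneg (rootDensity μ P θ x - 0 - t * inner ℝ (sdot θ₀ x) u)]
        · simp only [g, Set.indicator_of_notMem hx]
          nlinarith [sq_nonneg (rootDensity μ P θ x - rootDensity μ P θ₀ x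
            - inner ℝ (sdot θ₀ x) (t • u))]
      simp only [mul_pow, integral_const_mul] at h1 hθ ⊢
      have h2 : 0 < t ^ 2 := by positivity
      have h3 := h1.trans hθ
      have h4 : ε ^ 2 * (t ^ 2 * ‖u‖ ^ 2) = t ^ 2 * (ε ^ 2 * ‖u‖ ^ 2) := by ring
      rw [h4] at h3
      exact le_of_mul_le_mul_left h3 h2
    have h0 : ∫ x, g x ^ 2 ∂μ = 0 := by
      refine le_antisymm (le_of_forall_pos_le_add fun η hη => ?_)
        (integral_nonneg fun x => sq_nonneg _)
      refine (hle (√η / (‖u‖ + 1)) (by positivity)).trans ?_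
      rw [zero_add, div_mul_eq_mul_div, div_pow, mul_pow, Real.sq_sqrt hη.le,
        div_le_iff₀ (by positivity)]
      have : ‖u‖ ^ 2 ≤ (‖u‖ + 1) ^ 2 := by gcongr; linarith
      gcongr
    have := (integral_eq_zero_iff_of_nonneg (fun x => sq_nonneg (g x)) hg.integrable_sq).1 h0
    filter_upwards [this] with x hx hx0
    have hxA : x ∈ A := hx0
    simpa [g, hxA] using hx
  have hall : ∀ᵐ x ∂μ, ∀ i : Fin d, rootDensity μ P θ₀ x = 0 → sdot θ₀ x i = 0 := by
    refine eventually_all.2 fun i => ?_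
    filter_upwards [key (EuclideanSpace.single i 1), key (-EuclideanSpace.single i 1)]
      with x h1 h2 hx
    have h1 := h1 hx
    have h2 := h2 hx
    rw [inner_neg_right] at h2
    simp only [EuclideanSpace.inner_single_right] at h1 h2
    simp at h1 h2
    linarith
  filter_upwards [hall] with x hx hx0
  ext i
  exact hx i hx0

end IsRegularParametric

end Model


/-! ### Scores, projections and the first-order expansion -/

section Score

variable {𝓧 : Type*} [MeasurableSpace 𝓧] {d : ℕ} {Θ : Set (EuclideanSpace ℝ (Fin d))}
  {μ : Measure 𝓧} {P : Θ → Measure 𝓧} {sdot : Θ → 𝓧 → EuclideanSpace ℝ (Fin d)}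

lemma isSymmetric_inv_fisherInfo (θ : Θ) :
    (Matrix.toEuclideanLin (fisherInfo μ sdot θ)⁻¹).IsSymmetric := by
  refine Matrix.isSymmetric_toEuclideanLin_iff.2 (Matrix.IsHermitian.inv ?_)
  ext i j
  simp [fisherInfo, mul_comm]

namespace IsRegularParametric

variable (hmodel : IsRegularParametric μ P sdot)
include hmodel

lemma measurable_score (θ : Θ) : Measurable (score μ P sdot θ) :=
  (measurable_const.div (measurable_rootDensity θ)).smul (hmodel.measurable_sdot θ)

/-- On the zeros of the density the score is `0` by convention, so the identity there rests on
`sdot_eq_zero`. It converts integrals of scores under `P θ` into integrals of `ṡ` under `μ`. -/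
lemma rootDensity_smul_score (θ : Θ) :
    ∀ᵐ x ∂μ, rootDensity μ P θ x • score μ P sdot θ x = (2 : ℝ) • sdot θ x := by
  filter_upwards [hmodel.sdot_eq_zero θ] with x hx
  rw [score, smul_smul]
  by_cases h : rootDensity μ P θ x = 0
  · simp [hx h]
  · rw [mul_div_cancel₀ _ h]

lemma memLp_score (θ : Θ) : MemLp (score μ P sdot θ) 2 (P θ) := by
  refine (memLp_two_iff_integrable_sq_norm (hmodel.measurable_score θ).aestronglyMeasurable).2 ?_
  rw [hmodel.integrable_iff]
  refine (((hmodel.memLp_sdot θ).norm.integrable_sq).const_mul 4).congr ?_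
  filter_upwards [hmodel.rootDensity_smul_score θ] with x hx
  have h := congrArg (fun v => ‖v‖ ^ 2) hx
  simp only [norm_smul, mul_pow, Real.norm_eq_abs, sq_abs] at h
  rw [smul_eq_mul, h]
  norm_num

lemma integrable_score (θ : Θ) : Integrable (score μ P sdot θ) (P θ) := by
  have := hmodel.isProbabilityMeasure θ
  exact (hmodel.memLp_score θ).integrable one_le_two

lemma memLp_inner_score (θ : Θ) (c : EuclideanSpace ℝ (Fin d)) :
    MemLp (fun x => inner ℝ c (score μ P sdot θ x)) 2 (P θ) :=
  (hmodel.memLp_score θ).const_inner c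

/-- The information matrix is the covariance matrix of the score. -/
lemma integral_inner_score_mul (θ : Θ) (c k : EuclideanSpace ℝ (Fin d)) :
    ∫ x, inner ℝ c (score μ P sdot θ x) * inner ℝ k (score μ P sdot θ x) ∂(P θ) =
      inner ℝ k (Matrix.toEuclideanLin (fisherInfo μ sdot θ) c) := by
  have h1 : ∫ x, inner ℝ c (score μ P sdot θ x) * inner ℝ k (score μ P sdot θ x) ∂(P θ) =
      ∫ x, ∑ i, ∑ j, k i * (c j * (4 * (sdot θ x i * sdot θ x j))) ∂μ := by
    rw [hmodel.integral_eq]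
    refine integral_congr_ae ?_
    filter_upwards [hmodel.rootDensity_smul_score θ] with x hx
    have h1 : rootDensity μ P θ x ^ 2 • (inner ℝ c (score μ P sdot θ x) *
        inner ℝ k (score μ P sdot θ x)) = inner ℝ c (rootDensity μ P θ x • score μ P sdot θ x) *
        inner ℝ k (rootDensity μ P θ x • score μ P sdot θ x) := by
      rw [inner_smul_right, inner_smul_right, smul_eq_mul]
      ring
    rw [h1, hx, inner_smul_right, inner_smul_right, PiLp.inner_apply, PiLp.inner_apply]
    simp only [RCLike.inner_apply, conj_trivial]
    have h2 : (2 * ∑ i, sdot θ x i * c i) * (2 * ∑ i, sdot θ x i * k i) =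
        4 * ((∑ i, sdot θ x i * k i) * ∑ j, sdot θ x j * c j) := by ring
    rw [h2, Finset.sum_mul_sum, Finset.mul_sum]
    refine Finset.sum_congr rfl fun i _ => ?_
    rw [Finset.mul_sum]
    exact Finset.sum_congr rfl fun j _ => by ring
  have hcoord : ∀ i, MemLp (fun x => sdot θ x i) 2 μ := fun i => by
    have := hmodel.memLp_inner_sdot θ (EuclideanSpace.single i 1)
    simpa [EuclideanSpace.inner_single_right] using this
  have hint : ∀ i j, Integrable (fun x => k i * (c j * (4 * (sdot θ x i * sdot θ x j)))) μ :=
    fun i j => ((((hcoord i).integrable_mul (hcoord j)).const_mul _).const_mul _).const_mul _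
  rw [h1, integral_finsetSum _ fun i _ => integrable_finsetSum _ fun j _ => hint i j,
    PiLp.inner_apply]
  refine Finset.sum_congr rfl fun i _ => ?_
  rw [integral_finsetSum _ fun j _ => hint i j]
  simp only [integral_const_mul, Matrix.toLpLin_apply, Matrix.mulVec, dotProduct, fisherInfo,
    Matrix.of_apply, RCLike.inner_apply, conj_trivial, Finset.sum_mul]
  exact Finset.sum_congr rfl fun j _ => by ring

lemma fisherInfo_apply_inv (θ : Θ) (b : EuclideanSpace ℝ (Fin d)) :
    Matrix.toEuclideanLin (fisherInfo μ sdot θ)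
      (Matrix.toEuclideanLin (fisherInfo μ sdot θ)⁻¹ b) = b := by
  simp [Matrix.toLpLin_apply, Matrix.mul_nonsing_inv _ (hmodel.nonsingular θ)]

lemma inv_fisherInfo_apply (θ : Θ) (b : EuclideanSpace ℝ (Fin d)) :
    Matrix.toEuclideanLin (fisherInfo μ sdot θ)⁻¹
      (Matrix.toEuclideanLin (fisherInfo μ sdot θ) b) = b := by
  simp [Matrix.toLpLin_apply, Matrix.nonsing_inv_mul _ (hmodel.nonsingular θ)]

lemma integrable_smul_score {a : 𝓧 → ℝ} (θ : Θ) (ha : MemLp a 2 (P θ)) :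
    Integrable (fun x => a x • score μ P sdot θ x) (P θ) :=
  memLp_one_iff_integrable.1 ((hmodel.memLp_score θ).smul ha)

lemma inner_integral_smul_score {a : 𝓧 → ℝ} (θ : Θ) (ha : MemLp a 2 (P θ))
    (k : EuclideanSpace ℝ (Fin d)) :
    inner ℝ k (∫ x, a x • score μ P sdot θ x ∂(P θ)) =
      ∫ x, a x * inner ℝ k (score μ P sdot θ x) ∂(P θ) := by
  rw [← integral_inner (hmodel.integrable_smul_score θ ha)]
  simp only [inner_smul_right]

/-- The coefficients of the projection on the tangent space solve the normal equations. -/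
lemma projCoeff_eq {a : 𝓧 → ℝ} (θ : Θ) (ha : MemLp a 2 (P θ)) :
    projCoeff μ P sdot a θ = Matrix.toEuclideanLin (fisherInfo μ sdot θ)⁻¹
      (∫ x, a x • score μ P sdot θ x ∂(P θ)) := by
  set c₀ := Matrix.toEuclideanLin (fisherInfo μ sdot θ)⁻¹
    (∫ x, a x • score μ P sdot θ x ∂(P θ)) with hc₀
  have hs := hmodel.memLp_inner_score θ
  have hr : MemLp (fun x => a x - inner ℝ c₀ (score μ P sdot θ x)) 2 (P θ) := ha.sub (hs c₀)
  have horth : ∀ k, ∫ x, (a x - inner ℝ c₀ (score μ P sdot θ x)) *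
      inner ℝ k (score μ P sdot θ x) ∂(P θ) = 0 := by
    intro k
    simp only [sub_mul]
    rw [integral_sub (integrable_mul_of_memLp_two ha (hs k))
        (integrable_mul_of_memLp_two (hs c₀) (hs k)),
      ← hmodel.inner_integral_smul_score θ ha, hmodel.integral_inner_score_mul, hc₀,
      hmodel.fisherInfo_apply_inv, sub_self]
  have hpyth : ∀ c, ∫ x, (a x - inner ℝ c (score μ P sdot θ x)) ^ 2 ∂(P θ) =
      ∫ x, (a x - inner ℝ c₀ (score μ P sdot θ x)) ^ 2 ∂(P θ) +
        ∫ x, inner ℝ (c - c₀) (score μ P sdot θ x) ^ 2 ∂(P θ) := by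
    intro c
    have h1 := (integrable_mul_of_memLp_two hr (hs (c - c₀))).const_mul 2
    have h12 : Integrable (fun x => (a x - inner ℝ c₀ (score μ P sdot θ x)) ^ 2 +
        inner ℝ (c - c₀) (score μ P sdot θ x) ^ 2) (P θ) :=
      hr.integrable_sq.add (hs _).integrable_sq
    have h2 : ∀ x, (a x - inner ℝ c (score μ P sdot θ x)) ^ 2 =
        ((a x - inner ℝ c₀ (score μ P sdot θ x)) ^ 2 +
          inner ℝ (c - c₀) (score μ P sdot θ x) ^ 2) -
        2 * ((a x - inner ℝ c₀ (score μ P sdot θ x)) *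
          inner ℝ (c - c₀) (score μ P sdot θ x)) := by
      intro x
      rw [inner_sub_left]
      ring
    simp only [h2]
    rw [integral_sub h12 h1,
      integral_add hr.integrable_sq (hs _).integrable_sq, integral_const_mul, horth]
    ring
  have hmin : IsLeastSquares μ P sdot a θ c₀ := by
    intro c
    rw [hpyth c]
    exact le_add_of_nonneg_right (integral_nonneg fun x => sq_nonneg _)
  -- Existence of the minimizer `c₀` makes the chosen value a minimizer; by Pythagoras it gives the
  -- same tangent function almost everywhere, and nonsingular information identifies the
  -- coefficients.
  have hc : IsLeastSquares μ P sdot a θ (projCoeff μ P sdot a θ) :=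
    Classical.epsilon_spec ⟨c₀, hmin⟩
  set c := projCoeff μ P sdot a θ
  have h1 := hc c₀
  rw [hpyth c] at h1
  have h2 : ∫ x, inner ℝ (c - c₀) (score μ P sdot θ x) ^ 2 ∂(P θ) = 0 :=
    le_antisymm (by linarith) (integral_nonneg fun x => sq_nonneg _)
  have h3 := (integral_eq_zero_iff_of_nonneg (fun x => sq_nonneg _)
    (hs (c - c₀)).integrable_sq).1 h2
  have h4 : ∀ k, inner ℝ k (Matrix.toEuclideanLin (fisherInfo μ sdot θ) (c - c₀)) = 0 := by
    intro k
    rw [← hmodel.integral_inner_score_mul]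
    refine integral_eq_zero_of_ae ?_
    filter_upwards [h3] with x hx
    have hx : inner ℝ (c - c₀) (score μ P sdot θ x) = 0 := by simpa using hx
    simp [hx]
  have h5 := inner_self_eq_zero.1 (h4 _)
  have h6 := hmodel.inv_fisherInfo_apply θ (c - c₀)
  rw [h5, map_zero] at h6
  exact (sub_eq_zero.1 h6.symm)

/-- Symmetry of `I(θ)⁻¹` moves it from the coefficients onto the score, so the sums in the score
process involve the same influence function as the expansion of the estimator. -/
lemma tangentProj_eq {a : 𝓧 → ℝ} (θ : Θ) (ha : MemLp a 2 (P θ)) (x : 𝓧) :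
    tangentProj μ P sdot a θ x = inner ℝ (∫ y, a y • score μ P sdot θ y ∂(P θ))
      (efficientInfluence μ P sdot θ x) := by
  rw [tangentProj, hmodel.projCoeff_eq θ ha, efficientInfluence]
  exact isSymmetric_inv_fisherInfo θ _ _

/-- First-order expansion of `θ ↦ P_θ h_γ(·, θ')` at `θ' = θ`, uniformly in `γ`. -/
lemma eventually_abs_expansion_le {T : Type*} (θ₀ : Θ) {h : T → Θ → 𝓧 → ℝ}
    (hmeas : ∀ γ θ, Measurable (h γ θ)) {M : ℝ} (hM : 0 ≤ M) (hbd : ∀ γ θ x, |h γ θ x| ≤ M)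
    (hcont : ∀ ε : ℝ, 0 < ε → ∀ᶠ θ in 𝓝 θ₀, ∀ γ,
      ∫ x, (h γ θ x - h γ θ₀ x) ^ 2 ∂(P θ₀) ≤ ε ^ 2) {ε : ℝ} (hε : 0 < ε) :
    ∀ᶠ θ : Θ in 𝓝 θ₀, ∀ γ, |∫ x, h γ θ x ∂(P θ) - ∫ x, h γ θ x ∂(P θ₀)
        - inner ℝ ((θ : EuclideanSpace ℝ (Fin d)) - θ₀)
          (∫ x, h γ θ₀ x • score μ P sdot θ₀ x ∂(P θ₀))|
      ≤ ε * ‖(θ : EuclideanSpace ℝ (Fin d)) - θ₀‖ := by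
  let C : ℝ := √(∫ x, ‖sdot θ₀ x‖ ^ 2 ∂μ)
  have hC : 0 ≤ C := Real.sqrt_nonneg _
  have hC2 : ∫ x, ‖sdot θ₀ x‖ ^ 2 ∂μ = C ^ 2 :=
    (Real.sq_sqrt (integral_nonneg fun x => sq_nonneg _)).symm
  have hpP := hmodel.isProbabilityMeasure
  -- With `s - s₀ = D + R`, where `D` is the linear term and `h`, `h₀` are the test function at `θ`,
  -- `θ₀`, one has `h s² - h s₀² - 2 h₀ s₀ D = h (s - s₀)² + 2 h s₀ R + 2 (h - h₀) s₀ D`. Each term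
  -- gets `ε / 3 * ‖Δ‖`: the first is quadratic in `‖Δ‖` and needs `‖Δ‖ < η`, the second uses `ε₁`,
  -- the third the mean-square modulus `ε₂`. The bound `ε₁ ≤ 1` serves the first term.
  let ε₁ : ℝ := min 1 (ε / (6 * (M + 1)))
  have hε₁ : 0 < ε₁ := by positivity
  have hε₁1 : ε₁ ≤ 1 := min_le_left _ _
  let ε₂ : ℝ := ε / (6 * (C + 1))
  have hε₂ : 0 < ε₂ := by positivity
  let η : ℝ := ε / (6 * ((M + 1) * (1 + C ^ 2)))
  have hη : 0 < η := by positivity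
  have hclose : ∀ᶠ θ : Θ in 𝓝 θ₀, ‖(θ : EuclideanSpace ℝ (Fin d)) - θ₀‖ < η := by
    filter_upwards [Metric.ball_mem_nhds θ₀ hη] with θ hθ
    rw [← dist_eq_norm]
    exact hθ
  filter_upwards [hmodel.eventually_integral_remainder_sq_le θ₀ hε₁, hcont ε₂ hε₂, hclose]
    with θ hR hH hθη γ
  set Δ := (θ : EuclideanSpace ℝ (Fin d)) - θ₀
  let s := rootDensity μ P θ
  let s₀ := rootDensity μ P θ₀
  let D : 𝓧 → ℝ := fun x => inner ℝ (sdot θ₀ x) Δ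
  let R : 𝓧 → ℝ := fun x => s x - s₀ x - D x
  have hs : MemLp s 2 μ := hmodel.memLp_rootDensity θ
  have hs₀ : MemLp s₀ 2 μ := hmodel.memLp_rootDensity θ₀
  have hss : MemLp (fun x => s x - s₀ x) 2 μ := hs.sub hs₀
  have hDm : MemLp D 2 μ := hmodel.memLp_inner_sdot θ₀ Δ
  have hRm : MemLp R 2 μ := hmodel.memLp_remainder θ₀ θ Δ
  have hD : ∫ x, D x ^ 2 ∂μ ≤ (C * ‖Δ‖) ^ 2 := by
    rw [mul_pow, ← hC2, ← integral_mul_const]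
    refine integral_mono hDm.integrable_sq
      ((hmodel.memLp_sdot θ₀).norm.integrable_sq.mul_const _) fun x => ?_
    rw [← mul_pow, ← sq_abs]
    exact pow_le_pow_left₀ (abs_nonneg _) (abs_real_inner_le_norm _ _) 2
  have hmulm : ∀ {g f : 𝓧 → ℝ} {B : ℝ}, Measurable g → (∀ x, |g x| ≤ B) → MemLp f 2 μ →
      MemLp (fun x => g x * f x) 2 μ := fun {g f B} hg hb hf =>
    hf.mul' (p := ∞) (memLp_top_of_bound hg.aestronglyMeasurable B (Eventually.of_forall hb))
  have hbd' : ∀ θ x, |h γ θ x| ≤ M := hbd γ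
  -- the three terms of the expansion
  have hsplit : ∫ x, h γ θ x ∂(P θ) - ∫ x, h γ θ x ∂(P θ₀)
        - inner ℝ Δ (∫ x, h γ θ₀ x • score μ P sdot θ₀ x ∂(P θ₀)) =
      ∫ x, (h γ θ x * (s x - s₀ x)) * (s x - s₀ x) ∂μ + ∫ x, (h γ θ x * s₀ x) * (2 * R x) ∂μ +
        ∫ x, ((h γ θ x - h γ θ₀ x) * s₀ x) * (2 * D x) ∂μ := by
    have hLp : ∀ θ₁ θ₂, MemLp (h γ θ₁) 2 (P θ₂) := fun θ₁ θ₂ =>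
      MemLp.of_bound (hmeas γ θ₁).aestronglyMeasurable M (Eventually.of_forall (hbd γ θ₁))
    have h0 : ∫ x, h γ θ₀ x * inner ℝ Δ (score μ P sdot θ₀ x) ∂(P θ₀) =
        ∫ x, (h γ θ₀ x * s₀ x) * (2 * D x) ∂μ := by
      rw [hmodel.integral_eq]
      refine integral_congr_ae ?_
      filter_upwards [hmodel.rootDensity_smul_score θ₀] with x hx
      have h1 := congrArg (fun v => inner ℝ Δ v) hx
      simp only [inner_smul_right] at h1
      simp only [D, s₀, smul_eq_mul]
      rw [real_inner_comm Δ (sdot θ₀ x), ← h1]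
      ring
    have hi1 : Integrable (fun x => s x ^ 2 • h γ θ x) μ :=
      (hmodel.integrable_iff θ _).1 ((hLp θ θ).integrable one_le_two)
    have hi2 : Integrable (fun x => s₀ x ^ 2 • h γ θ x) μ :=
      (hmodel.integrable_iff θ₀ _).1 ((hLp θ θ₀).integrable one_le_two)
    have hi12 : Integrable (fun x => s x ^ 2 • h γ θ x - s₀ x ^ 2 • h γ θ x) μ := hi1.sub hi2
    have hi3 : Integrable (fun x => (h γ θ₀ x * s₀ x) * (2 * D x)) μ :=
      (hmulm (hmeas γ θ₀) (hbd' θ₀) hs₀).integrable_mul (hDm.const_mul 2)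
    have hi4 : Integrable (fun x => (h γ θ x * (s x - s₀ x)) * (s x - s₀ x)) μ :=
      (hmulm (hmeas γ θ) (hbd' θ) hss).integrable_mul hss
    have hi5 : Integrable (fun x => (h γ θ x * s₀ x) * (2 * R x)) μ :=
      (hmulm (hmeas γ θ) (hbd' θ) hs₀).integrable_mul (hRm.const_mul 2)
    have hi6 : Integrable (fun x => ((h γ θ x - h γ θ₀ x) * s₀ x) * (2 * D x)) μ := by
      refine (hmulm (B := M + M) ((hmeas γ θ).sub (hmeas γ θ₀)) (fun x => ?_) hs₀).integrable_mul
        (hDm.const_mul 2)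
      exact (abs_sub _ _).trans (add_le_add (hbd' θ x) (hbd' θ₀ x))
    have hi45 : Integrable (fun x => (h γ θ x * (s x - s₀ x)) * (s x - s₀ x) +
        (h γ θ x * s₀ x) * (2 * R x)) μ := hi4.add hi5
    rw [hmodel.inner_integral_smul_score θ₀ (hLp θ₀ θ₀), h0, hmodel.integral_eq θ,
      hmodel.integral_eq θ₀, ← integral_sub hi1 hi2, ← integral_sub hi12 hi3,
      ← integral_add hi4 hi5, ← integral_add hi45 hi6]
    refine integral_congr_ae (Eventually.of_forall fun x => ?_)
    simp only [R, s, s₀, smul_eq_mul]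
    ring
  have h1 : |∫ x, (h γ θ x * (s x - s₀ x)) * (s x - s₀ x) ∂μ| ≤ ε / 3 * ‖Δ‖ := by
    have h2 : ∫ x, (s x - s₀ x) ^ 2 ∂μ ≤ 2 * (1 + C ^ 2) * ‖Δ‖ ^ 2 := by
      calc ∫ x, (s x - s₀ x) ^ 2 ∂μ ≤ ∫ x, 2 * R x ^ 2 + 2 * D x ^ 2 ∂μ := by
            refine integral_mono hss.integrable_sq
              ((hRm.integrable_sq.const_mul 2).add (hDm.integrable_sq.const_mul 2)) fun x => ?_
            have : s x - s₀ x = R x + D x := by simp only [R]; ring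
            simp only [this]
            nlinarith [sq_nonneg (R x - D x)]
        _ = 2 * ∫ x, R x ^ 2 ∂μ + 2 * ∫ x, D x ^ 2 ∂μ := by
            rw [integral_add (hRm.integrable_sq.const_mul 2) (hDm.integrable_sq.const_mul 2),
              integral_const_mul, integral_const_mul]
        _ ≤ 2 * (ε₁ * ‖Δ‖) ^ 2 + 2 * (C * ‖Δ‖) ^ 2 := by gcongr
        _ ≤ 2 * (1 * ‖Δ‖) ^ 2 + 2 * (C * ‖Δ‖) ^ 2 := by gcongr
        _ = _ := by ring
    have h3 : |∫ x, (h γ θ x * (s x - s₀ x)) * (s x - s₀ x) ∂μ| ≤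
        M * ∫ x, (s x - s₀ x) ^ 2 ∂μ := by
      rw [← integral_const_mul, ← Real.norm_eq_abs]
      refine norm_integral_le_of_norm_le (hss.integrable_sq.const_mul M)
        (Eventually.of_forall fun x => ?_)
      rw [Real.norm_eq_abs, mul_assoc, ← sq, abs_mul, abs_of_nonneg (sq_nonneg (s x - s₀ x))]
      exact mul_le_mul_of_nonneg_right (hbd' θ x) (sq_nonneg _)
    calc _ ≤ M * ∫ x, (s x - s₀ x) ^ 2 ∂μ := h3
      _ ≤ (M + 1) * (2 * (1 + C ^ 2) * ‖Δ‖ ^ 2) := by gcongr; linarith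
      _ = 2 * ((M + 1) * (1 + C ^ 2)) * ‖Δ‖ * ‖Δ‖ := by ring
      _ ≤ 2 * ((M + 1) * (1 + C ^ 2)) * η * ‖Δ‖ := by gcongr
      _ = ε / 3 * ‖Δ‖ := by
          simp only [η]
          field_simp
          ring
  have h2 : |∫ x, (h γ θ x * s₀ x) * (2 * R x) ∂μ| ≤ ε / 3 * ‖Δ‖ := by
    have h3 := abs_integral_mul_le (a := M) (b := 2 * (ε₁ * ‖Δ‖))
      (hmulm (hmeas γ θ) (hbd' θ) hs₀) (hRm.const_mul 2) hM (by positivity) ?_ ?_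
    · refine h3.trans ?_
      have h4 : ε₁ ≤ ε / (6 * (M + 1)) := min_le_right _ _
      rw [le_div_iff₀ (by positivity)] at h4
      have h5 : M * (2 * ε₁) ≤ ε / 3 := by nlinarith
      nlinarith [norm_nonneg Δ]
    · rw [← mul_one (M ^ 2), ← hmodel.integral_rootDensity_sq θ₀, ← integral_const_mul]
      refine integral_mono (hmulm (hmeas γ θ) (hbd' θ) hs₀).integrable_sq
        (hs₀.integrable_sq.const_mul _) fun x => ?_
      simp only [mul_pow, s₀]
      exact mul_le_mul_of_nonneg_right (sq_le_sq' (abs_le.1 (hbd' θ x)).1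
        (abs_le.1 (hbd' θ x)).2) (sq_nonneg _)
    · simp only [mul_pow, integral_const_mul] at hR ⊢
      gcongr
  have h3 : |∫ x, ((h γ θ x - h γ θ₀ x) * s₀ x) * (2 * D x) ∂μ| ≤ ε / 3 * ‖Δ‖ := by
    have hm : MemLp (fun x => (h γ θ x - h γ θ₀ x) * s₀ x) 2 μ :=
      hmulm (B := M + M) ((hmeas γ θ).sub (hmeas γ θ₀))
        (fun x => (abs_sub _ _).trans (add_le_add (hbd' θ x) (hbd' θ₀ x))) hs₀
    have h3 := abs_integral_mul_le (a := ε₂) (b := 2 * (C * ‖Δ‖)) hm (hDm.const_mul 2)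
      hε₂.le (by positivity) ?_ ?_
    · refine h3.trans ?_
      have h5 : ε₂ * (2 * C) ≤ ε / 3 := by
        simp only [ε₂]
        rw [div_mul_eq_mul_div, div_le_iff₀ (by positivity)]
        nlinarith
      nlinarith [norm_nonneg Δ]
    · refine le_trans (le_of_eq ?_) (hH γ)
      rw [hmodel.integral_eq]
      simp only [mul_pow, smul_eq_mul, s₀, mul_comm]
    · simp only [mul_pow, integral_const_mul] at hD ⊢
      gcongr
  rw [hsplit]
  refine (abs_add_three _ _ _).trans ?_
  linarith

/-- The score has mean zero. -/
lemma integral_score_eq_zero (θ₀ : Θ) : ∫ x, score μ P sdot θ₀ x ∂(P θ₀) = 0 := by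
  have hpP := hmodel.isProbabilityMeasure
  set b := ∫ x, score μ P sdot θ₀ x ∂(P θ₀) with hb
  by_contra hne
  have hpos : 0 < ‖b‖ := norm_pos_iff.2 hne
  -- For the constant function `1` both integrals equal `1`, so only the linear term survives. Along
  -- the direction `b` this gives `t ‖b‖² ≤ t ‖b‖² / 2`, which is absurd for `b ≠ 0`.
  have h1 := hmodel.eventually_abs_expansion_le (T := Unit) θ₀ (h := fun _ _ _ => 1)
    (fun _ _ => measurable_const) zero_le_one (by simp)
    (fun ε hε => Eventually.of_forall fun θ γ => by simpa using sq_nonneg ε) (half_pos hpos)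
  obtain ⟨t, ht, θ, hθ, htb⟩ := exists_shift_mem hmodel.isOpen h1 b
  have h2 := hθ ()
  simp only [integral_const, probReal_univ, smul_eq_mul, one_smul, sub_self, zero_sub, abs_neg,
    htb, ← hb, real_inner_smul_left, real_inner_self_eq_norm_sq, norm_smul,
    Real.norm_of_nonneg ht.le] at h2
  rw [abs_of_nonneg (by positivity)] at h2
  nlinarith [mul_pos ht (mul_pos hpos hpos)]

end IsRegularParametric

end Score


/-! ### Chebyshev bounds for normalized sums -/

section Chebyshev

lemma tendsto_zero_of_eventually_le_ofReal {u : ℕ → ℝ≥0∞}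
    (h : ∀ η : ℝ, 0 < η → ∀ᶠ n in atTop, u n ≤ ENNReal.ofReal η) : Tendsto u atTop (𝓝 0) := by
  refine ENNReal.tendsto_nhds_zero.2 fun η hη => ?_
  obtain ⟨r, hr, hrη⟩ := ENNReal.lt_iff_exists_nnreal_btwn.1 hη
  filter_upwards [h r (by exact_mod_cast hr)] with n hn
  exact hn.trans (by simpa using hrη.le)

lemma sqrt_mul_inv_self (x : ℝ) : √x * x⁻¹ = (√x)⁻¹ := by
  rw [← div_eq_mul_inv, Real.sqrt_div_self]

lemma inv_sqrt_mul_self (x : ℝ) : (√x)⁻¹ * x = √x := by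
  rw [mul_comm, ← div_eq_mul_inv, Real.div_sqrt]

variable {𝓧 : Type*} [MeasurableSpace 𝓧] {P : Measure 𝓧} [IsProbabilityMeasure P]

/-- Chebyshev's inequality for the empirical process at a single function. -/
lemma sampleLaw_abs_gt_le {g : 𝓧 → ℝ} (hg : MemLp g 2 P) (n : ℕ) {ε : ℝ} (hε : 0 < ε) :
    sampleLaw P n {x | ε < |√(n : ℝ) * ((n : ℝ)⁻¹ * ∑ i, g (x i) - ∫ y, g y ∂P)|} ≤
      ENNReal.ofReal ((∫ x, g x ^ 2 ∂P) / ε ^ 2) := by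
  let Y : (Fin n → 𝓧) → ℝ := fun x => (√(n : ℝ))⁻¹ * ∑ i, g (x i)
  have hgi : ∀ i : Fin n, MemLp (fun x : Fin n → 𝓧 => g (x i)) 2 (sampleLaw P n) := fun i =>
    hg.comp_measurePreserving (measurePreserving_eval (fun _ => P) i)
  have hY : MemLp Y 2 (sampleLaw P n) := (memLp_finsetSum _ fun i _ => hgi i).const_mul _
  have hmean : ∫ x, Y x ∂(sampleLaw P n) = √(n : ℝ) * ∫ y, g y ∂P := by
    have h1 : ∀ i : Fin n, ∫ x : Fin n → 𝓧, g (x i) ∂(sampleLaw P n) = ∫ y, g y ∂P := fun i => by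
      have h := (measurePreserving_eval (fun _ : Fin n => P) i).map_eq
      conv_rhs => rw [← h]
      exact (integral_map (measurable_pi_apply i).aemeasurable (by
        have h1 : (sampleLaw P n).map (fun f => f i) = P := h
        rw [h1]; exact hg.1)).symm
    simp only [Y]
    rw [integral_const_mul, integral_finsetSum _ fun i _ => (hgi i).integrable one_le_two]
    simp only [h1, Finset.sum_const, Finset.card_univ, Fintype.card_fin, nsmul_eq_mul]
    rw [← mul_assoc, inv_sqrt_mul_self]
  have hvar : Var[Y; sampleLaw P n] ≤ ∫ x, g x ^ 2 ∂P := by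
    have h1 : Var[Y; sampleLaw P n] = ((√(n : ℝ))⁻¹) ^ 2 * (n * Var[g; P]) := by
      have h2 := variance_sum_pi (μ := fun _ : Fin n => P) (X := fun _ => g) fun _ => hg
      rw [Finset.sum_const, Finset.card_univ, Fintype.card_fin, nsmul_eq_mul] at h2
      have h3 : (∑ i : Fin n, fun x : Fin n → 𝓧 => g (x i)) = fun x => ∑ i, g (x i) := by
        ext x
        simp
      rw [variance_const_mul, ← h2, h3]
      rfl
    have h2 : Var[g; P] ≤ ∫ x, g x ^ 2 ∂P := variance_le_expectation_sq hg.1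
    rw [h1, inv_pow, Real.sq_sqrt (Nat.cast_nonneg n), ← mul_assoc]
    -- For the empty sample the normalization is `0` by convention and the variance bound is
    -- trivial.
    rcases eq_or_ne (n : ℝ) 0 with h | h
    · rw [h, inv_zero, zero_mul, zero_mul]
      exact integral_nonneg fun x => sq_nonneg _
    · rwa [inv_mul_cancel₀ h, one_mul]
  calc _ ≤ sampleLaw P n {x | ε ≤ |Y x - ∫ x, Y x ∂(sampleLaw P n)|} := by
        refine measure_mono fun x hx => ?_
        rw [Set.mem_ofPred_eq, mul_sub, ← mul_assoc, sqrt_mul_inv_self] at hx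
        rw [Set.mem_ofPred_eq, hmean]
        exact hx.le
    _ ≤ ENNReal.ofReal (Var[Y; sampleLaw P n] / ε ^ 2) := meas_ge_le_variance_div_sq hY hε
    _ ≤ _ := ENNReal.ofReal_le_ofReal (by gcongr)

/-- Chebyshev's inequality in each coordinate and a union bound: the variances of the normalized
sums do not grow with `n`. -/
lemma boundedInProbability_normalized_sum {d : ℕ} {ψ : 𝓧 → EuclideanSpace ℝ (Fin d)}
    (hψ : MemLp ψ 2 P) (hψ0 : ∫ x, ψ x ∂P = 0) :
    BoundedInProbability (sampleLaw P) fun (n : ℕ) x => (√(n : ℝ))⁻¹ • ∑ i, ψ (x i) := by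
  intro ε hε
  let V : ℝ := ∑ j, ∫ x, ψ x j ^ 2 ∂P
  have hV : 0 ≤ V := Finset.sum_nonneg fun j _ => integral_nonneg fun x => sq_nonneg _
  have hcoord : ∀ j, MemLp (fun x => ψ x j) 2 P := fun j => by
    have := hψ.inner_const (𝕜 := ℝ) (EuclideanSpace.single j 1)
    simpa [EuclideanSpace.inner_single_right] using this
  have hmean : ∀ j, ∫ x, ψ x j ∂P = 0 := fun j => by
    have := integral_inner (𝕜 := ℝ) (hψ.integrable one_le_two) (EuclideanSpace.single j 1)
    simpa [EuclideanSpace.inner_single_left, hψ0] using this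
  let r : ℝ := √((V + 1) / ε)
  have hr : 0 < r := by positivity
  refine ⟨d * r + 1, by positivity, Eventually.of_forall fun n => ?_⟩
  calc _ ≤ sampleLaw P n (⋃ j : Fin d,
        {x | r < |√(n : ℝ) * ((n : ℝ)⁻¹ * ∑ i, ψ (x i) j - ∫ y, ψ y j ∂P)|}) := by
        refine measure_mono fun x hx => ?_
        rw [Set.mem_ofPred_eq] at hx
        by_contra hcon
        simp only [Set.mem_iUnion, Set.mem_ofPred_eq, not_exists, not_lt, hmean, sub_zero,
          ← mul_assoc, sqrt_mul_inv_self] at hcon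
        have h1 : ‖(√(n : ℝ))⁻¹ • ∑ i, ψ (x i)‖ ≤ d * r := by
          have h2 : (√(n : ℝ))⁻¹ • ∑ i, ψ (x i) = ∑ j,
              EuclideanSpace.single j ((√(n : ℝ))⁻¹ * ∑ i, ψ (x i) j) := by
            ext k
            simp [Pi.single_apply]
          rw [h2]
          refine (norm_sum_le _ _).trans ?_
          simp only [PiLp.norm_single, Real.norm_eq_abs]
          refine (Finset.sum_le_sum fun j _ => hcon j).trans ?_
          simp
        linarith
    _ ≤ ∑ j : Fin d, ENNReal.ofReal ((∫ x, ψ x j ^ 2 ∂P) / r ^ 2) :=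
        (measure_iUnion_fintype_le _ _).trans
          (Finset.sum_le_sum fun j _ => sampleLaw_abs_gt_le (hcoord j) n hr)
    _ = ENNReal.ofReal (V / r ^ 2) := by
        rw [← ENNReal.ofReal_sum_of_nonneg fun j _ =>
          div_nonneg (integral_nonneg fun x => sq_nonneg _) (sq_nonneg _), ← Finset.sum_div]
    _ ≤ ENNReal.ofReal ε := by
        refine ENNReal.ofReal_le_ofReal ?_
        rw [Real.sq_sqrt (by positivity), div_div_eq_mul_div, div_le_iff₀ (by positivity)]
        nlinarith

end Chebyshev

/-! ### Orthogonality and the score process as a projected empirical process -/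

section ScoreLimit

variable {𝓧 : Type*} [MeasurableSpace 𝓧] {d : ℕ} {Θ : Set (EuclideanSpace ℝ (Fin d))}
  {μ : Measure 𝓧} {P : Θ → Measure 𝓧} {sdot : Θ → 𝓧 → EuclideanSpace ℝ (Fin d)} {T : Type*}
  {h : T → Θ → 𝓧 → ℝ}

namespace IsRegularParametric

variable (hmodel : IsRegularParametric μ P sdot)
include hmodel

lemma memLp_efficientInfluence (θ : Θ) : MemLp (efficientInfluence μ P sdot θ) 2 (P θ) :=
  (Matrix.toEuclideanLin (fisherInfo μ sdot θ)⁻¹).toContinuousLinearMap.comp_memLp'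
    (hmodel.memLp_score θ)

lemma integral_efficientInfluence (θ : Θ) :
    ∫ x, efficientInfluence μ P sdot θ x ∂(P θ) = 0 := by
  have := (Matrix.toEuclideanLin (fisherInfo μ sdot θ)⁻¹).toContinuousLinearMap.integral_comp_comm
    (hmodel.integrable_score θ)
  rw [hmodel.integral_score_eq_zero, map_zero] at this
  exact this

lemma integral_tangentProj (θ : Θ) (a : 𝓧 → ℝ) :
    ∫ x, tangentProj μ P sdot a θ x ∂(P θ) = 0 := by
  simp only [tangentProj]
  rw [integral_inner (hmodel.integrable_score θ), hmodel.integral_score_eq_zero, inner_zero_right]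

lemma memLp_tangentProj (θ : Θ) (a : 𝓧 → ℝ) : MemLp (tangentProj μ P sdot a θ) 2 (P θ) :=
  hmodel.memLp_inner_score θ _

/-- `tangentProj` is the orthogonal projection on the tangent space. -/
lemma integral_mul_tangentProj (θ : Θ) {a a' : 𝓧 → ℝ} (ha : MemLp a 2 (P θ)) :
    ∫ x, a x * tangentProj μ P sdot a' θ x ∂(P θ) =
      ∫ x, tangentProj μ P sdot a θ x * tangentProj μ P sdot a' θ x ∂(P θ) := by
  simp only [tangentProj]
  rw [← hmodel.inner_integral_smul_score θ ha, hmodel.integral_inner_score_mul,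
    hmodel.projCoeff_eq θ ha, hmodel.fisherInfo_apply_inv]

lemma covariance_tangentProj (θ : Θ) {a a' : 𝓧 → ℝ} (ha : MemLp a 2 (P θ)) :
    cov[a, tangentProj μ P sdot a' θ; P θ] =
      cov[tangentProj μ P sdot a θ, tangentProj μ P sdot a' θ; P θ] := by
  have := hmodel.isProbabilityMeasure θ
  rw [covariance_eq_sub ha (hmodel.memLp_tangentProj θ a'),
    covariance_eq_sub (hmodel.memLp_tangentProj θ a) (hmodel.memLp_tangentProj θ a'),
    hmodel.integral_tangentProj, mul_zero, mul_zero]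
  simp only [Pi.mul_apply]
  rw [hmodel.integral_mul_tangentProj θ ha]

/-- Expanding the covariance of `h - Π h` bilinearly, orthogonality makes each cross term equal to
the covariance of the two projections; two of the three such terms cancel. -/
lemma integral_summand_mul_summand (θ : Θ) (hh : ∀ γ, MemLp (h γ θ) 2 (P θ)) (s t : T) :
    ∫ x, (h s θ x - ∫ y, h s θ y ∂(P θ) - tangentProj μ P sdot (h s θ) θ x) *
      (h t θ x - ∫ y, h t θ y ∂(P θ) - tangentProj μ P sdot (h t θ) θ x) ∂(P θ) =
      limitCov μ P sdot h θ s t := by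
  have := hmodel.isProbabilityMeasure θ
  have hproj := fun γ => hmodel.memLp_tangentProj θ (h γ θ)
  have h1 : ∀ γ, ∫ x, h γ θ x - tangentProj μ P sdot (h γ θ) θ x ∂(P θ) =
      ∫ x, h γ θ x ∂(P θ) := fun γ => by
    rw [integral_sub ((hh γ).integrable one_le_two) ((hproj γ).integrable one_le_two),
      hmodel.integral_tangentProj, sub_zero]
  have h2 := covariance_fun_sub_fun_sub (hh s) (hproj s) (hh t) (hproj t)
  rw [hmodel.covariance_tangentProj θ (hh s), covariance_comm (tangentProj μ P sdot (h s θ) θ)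
    (h t θ), hmodel.covariance_tangentProj θ (hh t),
    covariance_comm (tangentProj μ P sdot (h t θ) θ)] at h2
  rw [limitCov]
  calc _ = cov[fun x => h s θ x - tangentProj μ P sdot (h s θ) θ x,
        fun x => h t θ x - tangentProj μ P sdot (h t θ) θ x; P θ] := by
        rw [covariance]
        refine integral_congr_ae (Eventually.of_forall fun x => ?_)
        simp only [h1]
        ring
    _ = _ := by rw [h2]; ring

lemma norm_integral_smul_score_le (θ : Θ) {a : 𝓧 → ℝ} {M : ℝ} (ha : ∀ x, |a x| ≤ M) :
    ‖∫ x, a x • score μ P sdot θ x ∂(P θ)‖ ≤ M * ∫ x, ‖score μ P sdot θ x‖ ∂(P θ) := by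
  rw [← integral_const_mul]
  refine norm_integral_le_of_norm_le ((hmodel.integrable_score θ).norm.const_mul M)
    (Eventually.of_forall fun x => ?_)
  rw [norm_smul]
  exact mul_le_mul_of_nonneg_right (ha x) (norm_nonneg _)

/-- The score process is the empirical process minus its projection on the tangent space. -/
lemma scoreProcess_eq (θ : Θ) (hh : ∀ γ, MemLp (h γ θ) 2 (P θ)) (n : ℕ) (x : Fin n → 𝓧) (γ : T) :
    scoreProcess μ P sdot h θ n x γ = empiricalProcess (P θ) (fun γ => h γ θ) n x γ -
      inner ℝ (∫ y, h γ θ y • score μ P sdot θ y ∂(P θ))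
        ((√(n : ℝ))⁻¹ • ∑ i, efficientInfluence μ P sdot θ (x i)) := by
  simp only [scoreProcess, empiricalProcess, hmodel.tangentProj_eq θ (hh γ), inner_smul_right,
    inner_sum, Finset.sum_sub_distrib, Finset.sum_const, Finset.card_univ, Fintype.card_fin,
    nsmul_eq_mul]
  rw [mul_sub, mul_sub, mul_sub, ← mul_assoc, ← mul_assoc, inv_sqrt_mul_self, sqrt_mul_inv_self]

end IsRegularParametric

end ScoreLimit


/-! ### Limit of the score process and comparison with the estimated process -/

section ScoreLimit

variable {𝓧 : Type*} [MeasurableSpace 𝓧] {d : ℕ} {Θ : Set (EuclideanSpace ℝ (Fin d))}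
  {μ : Measure 𝓧} {P : Θ → Measure 𝓧} {sdot : Θ → 𝓧 → EuclideanSpace ℝ (Fin d)} {T : Type*}
  {h : T → Θ → 𝓧 → ℝ} {M : ℝ}

lemma memLp_of_abs_le [∀ θ, IsProbabilityMeasure (P θ)] (hmeas : ∀ γ θ, Measurable (h γ θ))
    (hbd : ∀ γ θ x, |h γ θ x| ≤ M) (γ : T) (θ θ' : Θ) : MemLp (h γ θ) 2 (P θ') :=
  MemLp.of_bound (hmeas γ θ).aestronglyMeasurable M (Eventually.of_forall (hbd γ θ))

lemma memlp_estimatedProcess [∀ θ, IsProbabilityMeasure (P θ)] (hbd : ∀ γ θ x, |h γ θ x| ≤ M)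
    (est : ∀ n, (Fin n → 𝓧) → Θ) (n : ℕ) (x : Fin n → 𝓧) :
    Memℓp (estimatedProcess P est h n x) ∞ := by
  refine memℓp_infty ⟨√(n : ℝ) * ((n : ℝ)⁻¹ * ∑ _i : Fin n, M + M), ?_⟩
  rintro _ ⟨γ, rfl⟩
  simp only [estimatedProcess, empiricalProcess, norm_mul, Real.norm_eq_abs,
    abs_of_nonneg (Real.sqrt_nonneg _)]
  refine mul_le_mul_of_nonneg_left ((abs_sub _ _).trans (add_le_add ?_ ?_)) (Real.sqrt_nonneg _)
  · rw [abs_mul, abs_of_nonneg (by positivity : (0 : ℝ) ≤ (n : ℝ)⁻¹)]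
    refine mul_le_mul_of_nonneg_left ?_ (by positivity)
    exact (Finset.abs_sum_le_sum_abs _ _).trans (Finset.sum_le_sum fun i _ => hbd _ _ _)
  · have := norm_integral_le_of_norm_le_const (μ := P (est n x)) (f := h γ (est n x)) (C := M)
      (Eventually.of_forall fun y => hbd γ (est n x) y)
    simpa using this

/-- The increments of a bounded empirical process are small in probability when the indices are
close in mean square. -/
lemma empiricalProcess_increment_le {S : Type*} {P : Measure 𝓧} [IsProbabilityMeasure P]
    {g : S → 𝓧 → ℝ} (hg : ∀ s, MemLp (g s) 2 P) {ε η : ℝ} (hε : 0 < ε) (hη : 0 < η) :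
    ∃ δ : ℝ, 0 < δ ∧ ∀ s t, ∫ x, (g s x - g t x) ^ 2 ∂P < δ → ∀ n,
      sampleLaw P n {x | ε < |(empiricalProcess P g n x s) - empiricalProcess P g n x t|} ≤
        ENNReal.ofReal η := by
  refine ⟨η * ε ^ 2, by positivity, fun s t hst n => ?_⟩
  have h1 := sampleLaw_abs_gt_le ((hg s).sub (hg t)) n hε
  simp only [Pi.sub_apply] at h1
  rw [integral_sub ((hg s).integrable one_le_two) ((hg t).integrable one_le_two)] at h1
  refine le_trans (measure_mono fun x hx => ?_) (h1.trans (ENNReal.ofReal_le_ofReal ?_))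
  · rw [Set.mem_ofPred_eq] at hx ⊢
    convert hx using 2
    simp only [empiricalProcess, Finset.sum_sub_distrib]
    ring
  · rw [div_le_iff₀ (by positivity)]
    exact hst.le

namespace IsRegularParametric

variable (hmodel : IsRegularParametric μ P sdot)
include hmodel

lemma memlp_scoreProcess (hmeas : ∀ γ θ, Measurable (h γ θ)) (hbd : ∀ γ θ x, |h γ θ x| ≤ M)
    (θ : Θ) (n : ℕ) (x : Fin n → 𝓧) : Memℓp (scoreProcess μ P sdot h θ n x) ∞ := by
  have hP := hmodel.isProbabilityMeasure
  have h1 : Memℓp (estimatedProcess P (fun _ _ => θ) h n x) ∞ := memlp_estimatedProcess hbd _ n x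
  have h2 : Memℓp (fun γ => inner ℝ (∫ y, h γ θ y • score μ P sdot θ y ∂(P θ))
      ((√(n : ℝ))⁻¹ • ∑ i, efficientInfluence μ P sdot θ (x i))) ∞ := by
    refine memℓp_infty ⟨(M * ∫ x, ‖score μ P sdot θ x‖ ∂(P θ)) *
      ‖(√(n : ℝ))⁻¹ • ∑ i, efficientInfluence μ P sdot θ (x i)‖, ?_⟩
    rintro _ ⟨γ, rfl⟩
    exact (norm_inner_le_norm _ _).trans
      (mul_le_mul_of_nonneg_right (hmodel.norm_integral_smul_score_le θ (hbd γ θ)) (norm_nonneg _))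
  convert h1.sub h2 using 1
  ext γ
  exact hmodel.scoreProcess_eq θ (fun γ => memLp_of_abs_le hmeas hbd γ θ θ) n x γ

/-- The score process at the true parameter converges weakly to a tight Gaussian process. -/
theorem exists_weak_limit_scoreProcess (hmeas : ∀ γ θ, Measurable (h γ θ))
    (hbd : ∀ γ θ x, |h γ θ x| ≤ M) (θ₀ : Θ)
    (htight : AsymptoticallyTight (sampleLaw (P θ₀))
      (empiricalProcess (P θ₀) (fun t : T × Θ => h t.1 t.2))) :
    ∃ ν : Measure (LInf T), IsTightCenteredGaussian ν (limitCov μ P sdot h θ₀) ∧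
      ConvergesWeakly (sampleLaw (P θ₀)) (scoreProcess μ P sdot h θ₀) ν := by
  have hP := hmodel.isProbabilityMeasure
  have hLp : ∀ γ, MemLp (h γ θ₀) 2 (P θ₀) := fun γ => memLp_of_abs_le hmeas hbd γ θ₀ θ₀
  have hproj := hmodel.memLp_tangentProj θ₀
  have hosc : FiniteOscillation (sampleLaw (P θ₀)) (scoreProcess μ P sdot h θ₀) := by
    have h1 := (htight.finiteOscillation.comp fun γ => (γ, θ₀)).sub
      (FiniteOscillation.inner (boundedInProbability_normalized_sum
        (hmodel.memLp_efficientInfluence θ₀) (hmodel.integral_efficientInfluence θ₀))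
        fun γ => hmodel.norm_integral_smul_score_le θ₀ (hbd γ θ₀))
    have h2 := funext fun n => funext fun x => funext (hmodel.scoreProcess_eq θ₀ hLp n x)
    rw [h2]
    exact h1
  have hf2 : ∀ γ, MemLp (fun x => h γ θ₀ x - ∫ y, h γ θ₀ y ∂(P θ₀) -
      tangentProj μ P sdot (h γ θ₀) θ₀ x) 2 (P θ₀) := fun γ =>
    ((hLp γ).sub (memLp_const _)).sub (hproj _)
  obtain ⟨ν, hν, hconv⟩ := exists_gaussian_limit (P := P θ₀)
    (f := fun γ x => h γ θ₀ x - ∫ y, h γ θ₀ y ∂(P θ₀) - tangentProj μ P sdot (h γ θ₀) θ₀ x)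
    (fun γ => ((hmeas γ θ₀).sub_const _).sub (measurable_const.inner (hmodel.measurable_score θ₀)))
    hf2 (fun γ => by
      have hc : Integrable (fun x => h γ θ₀ x - ∫ y, h γ θ₀ y ∂(P θ₀)) (P θ₀) :=
        ((hLp γ).integrable one_le_two).sub (integrable_const _)
      rw [integral_sub hc ((hproj _).integrable one_le_two),
        integral_sub ((hLp γ).integrable one_le_two)
        (integrable_const _), hmodel.integral_tangentProj]
      simp) (hmodel.memlp_scoreProcess hmeas hbd θ₀) hosc
  refine ⟨ν, ?_, hconv⟩
  convert hν using 1
  ext s t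
  exact (hmodel.integral_summand_mul_summand θ₀ hLp s t).symm

/-- With an efficient estimator, the estimated process is uniformly close to the score process. -/
theorem uniformlyNegligible_estimatedProcess_sub (hmeas : ∀ γ θ, Measurable (h γ θ))
    (hM : 0 ≤ M) (hbd : ∀ γ θ x, |h γ θ x| ≤ M) (θ₀ : Θ)
    (htight : AsymptoticallyTight (sampleLaw (P θ₀))
      (empiricalProcess (P θ₀) (fun t : T × Θ => h t.1 t.2)))
    (hcont : ∀ ε : ℝ, 0 < ε → ∀ᶠ θ in 𝓝 θ₀, ∀ γ,
      ∫ x, (h γ θ x - h γ θ₀ x) ^ 2 ∂(P θ₀) ≤ ε ^ 2)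
    {est : ∀ n, (Fin n → 𝓧) → Θ} (heff : IsEfficientEstimatorAt μ P sdot est θ₀) :
    UniformlyNegligible (sampleLaw (P θ₀))
      (fun n x γ => estimatedProcess P est h n x γ - scoreProcess μ P sdot h θ₀ n x γ) := by
  have hP := hmodel.isProbabilityMeasure
  intro ε hε
  refine tendsto_zero_of_eventually_le_ofReal fun η hη => ?_
  let b : T → EuclideanSpace ℝ (Fin d) := fun γ => ∫ x, h γ θ₀ x • score μ P sdot θ₀ x ∂(P θ₀)
  let S : ∀ n, (Fin n → 𝓧) → EuclideanSpace ℝ (Fin d) := fun n x =>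
    (√(n : ℝ))⁻¹ • ∑ i, efficientInfluence μ P sdot θ₀ (x i)
  let B : ℝ := M * ∫ x, ‖score μ P sdot θ₀ x‖ ∂(P θ₀)
  have hb : ∀ γ, ‖b γ‖ ≤ B := fun γ => hmodel.norm_integral_smul_score_le θ₀ (hbd γ θ₀)
  have hB : 0 ≤ B := mul_nonneg hM (integral_nonneg fun x => norm_nonneg _)
  let κ : ℝ := ε / (3 * (B + 1))
  have hκ : 0 < κ := by positivity
  obtain ⟨R, hR, hSR⟩ := boundedInProbability_normalized_sum (hmodel.memLp_efficientInfluence θ₀)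
    (hmodel.integral_efficientInfluence θ₀) (η / 3) (by positivity)
  -- Equicontinuity holds over all pairs of indices at once, so the random index `(γ, est n x)` may
  -- be inserted.
  obtain ⟨δ, hδ, hequi⟩ := htight.finiteOscillation.equicontinuous
    (ρ := fun s t => ∫ x, (h s.1 s.2 x - h t.1 t.2 x) ^ 2 ∂(P θ₀))
    (fun ε η hε hη => empiricalProcess_increment_le
      (fun s : T × Θ => memLp_of_abs_le hmeas hbd s.1 s.2 θ₀) hε hη)
    (ε := min (ε / 3) (η / 3)) (by positivity)
  -- a neighbourhood of `θ₀` on which the expansion and the mean-square continuity are accurate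
  have hnear := (hmodel.eventually_abs_expansion_le θ₀ hmeas hM hbd hcont
    (show 0 < ε / (3 * (R + κ)) by positivity)).and (hcont (√(δ / 2)) (by positivity))
  obtain ⟨r, hr, hnear⟩ := Metric.eventually_nhds_iff.1 hnear
  -- On the good event `√n ‖Δ‖ ≤ R + κ`, so for such `n` the estimate lies within `r` of `θ₀`.
  have hlarge : ∀ᶠ n : ℕ in atTop, (R + κ) / r < √(n : ℝ) :=
    (Real.tendsto_sqrt_atTop.comp tendsto_natCast_atTop_atTop).eventually_gt_atTop _
  filter_upwards [hSR, hequi, ENNReal.tendsto_nhds_zero.1 (heff κ hκ) (ENNReal.ofReal (η / 3))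
    (ENNReal.ofReal_pos.2 (by positivity)), hlarge] with n h1 h2 h3 hn
  have hn0 : 0 < √(n : ℝ) := lt_trans (by positivity) hn
  let G : (Fin n → 𝓧) → T × Θ → ℝ := empiricalProcess (P θ₀) (fun t : T × Θ => h t.1 t.2) n
  let A₁ : Set (Fin n → 𝓧) := {x | ∃ s t : T × Θ, ∫ x, (h s.1 s.2 x - h t.1 t.2 x) ^ 2 ∂(P θ₀) < δ ∧
    min (ε / 3) (η / 3) < |G x s - G x t|}
  let A₂ : Set (Fin n → 𝓧) := {x | R < ‖S n x‖}
  let A₃ : Set (Fin n → 𝓧) := {x | κ < ‖√(n : ℝ) • ((est n x : EuclideanSpace ℝ (Fin d)) - θ₀)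
    - S n x‖}
  have hsub : {x | ∃ γ, ε < |(estimatedProcess P est h n x γ) - scoreProcess μ P sdot h θ₀ n x γ|} ⊆
      A₁ ∪ A₂ ∪ A₃ := by
    rintro x ⟨γ, hγ⟩
    by_contra hcon
    simp only [A₁, A₂, A₃, Set.mem_union, Set.mem_ofPred_eq, not_or, not_exists, not_and,
      not_lt] at hcon
    obtain ⟨⟨hG, hS⟩, hE⟩ := hcon
    set Δ := (est n x : EuclideanSpace ℝ (Fin d)) - θ₀
    have hΔ : √(n : ℝ) * ‖Δ‖ ≤ R + κ := by
      have := norm_add_le (√(n : ℝ) • Δ - S n x) (S n x)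
      rw [sub_add_cancel, norm_smul, Real.norm_of_nonneg hn0.le] at this
      linarith
    have hdist : dist (est n x) θ₀ < r := by
      rw [Subtype.dist_eq, dist_eq_norm]
      rw [div_lt_iff₀ hr] at hn
      exact lt_of_mul_lt_mul_left (hΔ.trans_lt hn) hn0.le
    obtain ⟨hexp, hms⟩ := hnear hdist
    have hexp := hexp γ
    have hms := hms γ
    rw [Real.sq_sqrt (by positivity)] at hms
    have hGγ := (hG (γ, est n x) (γ, θ₀) (by simp only; linarith)).trans (min_le_left _ _)
    -- The `⟨b γ, √n Δ⟩` subtracted in the remainder of the expansion reappears in the last term,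
    -- where it is matched with `⟨b γ, S n x⟩` from the score process.
    have hdec : estimatedProcess P est h n x γ - scoreProcess μ P sdot h θ₀ n x γ =
        (G x (γ, est n x) - G x (γ, θ₀)) -
        √(n : ℝ) * (∫ y, h γ (est n x) y ∂(P (est n x)) - ∫ y, h γ (est n x) y ∂(P θ₀) -
          inner ℝ Δ (b γ)) - inner ℝ (b γ) (√(n : ℝ) • Δ - S n x) := by
      rw [hmodel.scoreProcess_eq θ₀ (fun γ => memLp_of_abs_le hmeas hbd γ θ₀ θ₀)]
      simp only [estimatedProcess, empiricalProcess, G, inner_sub_right, inner_smul_right, b, S,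
        real_inner_comm Δ]
      ring
    have ht2 : |√(n : ℝ) * (∫ y, h γ (est n x) y ∂(P (est n x)) - ∫ y, h γ (est n x) y ∂(P θ₀) -
        inner ℝ Δ (b γ))| ≤ ε / 3 := by
      rw [abs_mul, abs_of_pos hn0]
      calc _ ≤ √(n : ℝ) * (ε / (3 * (R + κ)) * ‖Δ‖) := by gcongr
        _ = ε / (3 * (R + κ)) * (√(n : ℝ) * ‖Δ‖) := by ring
        _ ≤ ε / (3 * (R + κ)) * (R + κ) := by gcongr
        _ = ε / 3 := by
            have : 0 < R + κ := by positivity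
            field_simp
    have ht3 : |inner ℝ (b γ) (√(n : ℝ) • Δ - S n x)| ≤ ε / 3 := by
      refine (abs_real_inner_le_norm _ _).trans ?_
      calc _ ≤ (B + 1) * κ := by
            gcongr
            exact (hb γ).trans (by linarith)
        _ = ε / 3 := by
            simp only [κ]
            field_simp
    rw [hdec] at hγ
    have h5 := abs_sub (G x (γ, est n x) - G x (γ, θ₀) - √(n : ℝ) *
      (∫ y, h γ (est n x) y ∂(P (est n x)) - ∫ y, h γ (est n x) y ∂(P θ₀) - inner ℝ Δ (b γ)))
      (inner ℝ (b γ) (√(n : ℝ) • Δ - S n x))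
    have h6 := abs_sub (G x (γ, est n x) - G x (γ, θ₀)) (√(n : ℝ) *
      (∫ y, h γ (est n x) y ∂(P (est n x)) - ∫ y, h γ (est n x) y ∂(P θ₀) - inner ℝ Δ (b γ)))
    linarith
  have h2 : sampleLaw (P θ₀) n A₁ ≤ ENNReal.ofReal (η / 3) :=
    h2.trans (ENNReal.ofReal_le_ofReal (min_le_right _ _))
  calc _ ≤ sampleLaw (P θ₀) n (A₁ ∪ A₂ ∪ A₃) := measure_mono hsub
    _ ≤ sampleLaw (P θ₀) n A₁ + sampleLaw (P θ₀) n A₂ + sampleLaw (P θ₀) n A₃ :=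
        (measure_union_le _ _).trans (add_le_add_left (measure_union_le _ _) _)
    _ ≤ ENNReal.ofReal (η / 3) + ENNReal.ofReal (η / 3) + ENNReal.ofReal (η / 3) :=
        add_le_add (add_le_add h2 h1) h3
    _ = ENNReal.ofReal η := by
        rw [← ENNReal.ofReal_add (by positivity) (by positivity),
          ← ENNReal.ofReal_add (by positivity) (by positivity)]
        congr 1
        ring

end IsRegularParametric

end ScoreLimit

end ScoreProcess

/-! ### Assembly of the limit theorem -/

theorem proposition4p2
    {𝓧 : Type*} [MeasurableSpace 𝓧] {d p : ℕ}
    -- the regular parametric hypothesis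
    (Θ : Set (EuclideanSpace ℝ (Fin d))) (μ : Measure 𝓧) (P : Θ → Measure 𝓧)
    (sdot : Θ → 𝓧 → EuclideanSpace ℝ (Fin d)) (hmodel : IsRegularParametric μ P sdot)
    -- the test functions
    (Γ : Set (Fin p → EReal)) (h : Γ → Θ → 𝓧 → ℝ) (hmeas : ∀ γ θ, Measurable (h γ θ))
    -- the estimator, regular on `Θ`
    (est : ∀ n, (Fin n → 𝓧) → Θ) (hest : ∀ n, Measurable (est n))
    (hR1 : ∀ θ, IsRegularEstimatorAt P est θ)
    -- the true parameter
    (θ₀ : Θ)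
    (hR2_compact : IsCompact Γ)
    (hR2_tight : AsymptoticallyTight (sampleLaw (P θ₀))
      (empiricalProcess (P θ₀) (fun t : Γ × Θ => h t.1 t.2)))
    (hR2_bounded : ∃ M : ℝ, ∀ γ θ x, |h γ θ x| ≤ M)
    (hR3 : ∀ θ₁ : Θ, ∀ ε : ℝ, 0 < ε → ∀ᶠ θ in 𝓝 θ₁, ∀ γ,
      ∫ x, (h γ θ x - h γ θ₁ x) ^ 2 ∂(P θ₀) ≤ ε ^ 2)
    (heff : IsEfficientEstimatorAt μ P sdot est θ₀) :
    ∃ ν : Measure (LInf Γ),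
      IsTightCenteredGaussian ν (limitCov μ P sdot h θ₀) ∧
      ConvergesWeakly (sampleLaw (P θ₀)) (scoreProcess μ P sdot h θ₀) ν ∧
      UniformlyNegligible (sampleLaw (P θ₀))
        (fun n x γ => estimatedProcess P est h n x γ - scoreProcess μ P sdot h θ₀ n x γ) ∧
      ConvergesWeakly (sampleLaw (P θ₀)) (estimatedProcess P est h) ν := by
  obtain ⟨M, hM⟩ := hR2_bounded
  -- If `Γ` is empty, `M` may be negative.
  have hbd : ∀ γ θ x, |h γ θ x| ≤ max M 0 := fun γ θ x => (hM γ θ x).trans (le_max_left _ _)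
  have hP := hmodel.isProbabilityMeasure
  obtain ⟨ν, hν, hconv⟩ := hmodel.exists_weak_limit_scoreProcess hmeas hbd θ₀ hR2_tight
  have hneg := hmodel.uniformlyNegligible_estimatedProcess_sub hmeas (le_max_right _ _) hbd θ₀
    hR2_tight (hR3 θ₀) heff
  have := hν.isProbabilityMeasure
  exact ⟨ν, hν, hconv, hneg,
    hconv.of_uniformlyNegligible (memlp_estimatedProcess hbd est) hneg⟩
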